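/- Consider a status update system with an energy harvesting transmitter. Status packets and energy packets arrive according to two independent Poisson processes of rates $\lambda>0$ and $r>0$, with $\lambda\neq r$ (in particular this covers the case $\lambda<r$), and put $\theta=\lambda/r$. Status packets are stored in a data buffer of capacity $K\ge 1$ and energy packets in a battery of capacity $B\ge 1$; an energy packet that finds the battery full is discarded. Sending one status packet consumes one energy packet and takes no time, and the server is work-conserving: a packet is sent whenever the data buffer and the battery are both nonempty. The discipline is last-come-first-served (LCFS): the freshest stored packet is sent first, and if a status packet arrives when the data buffer is full, the oldest stored packet is discarded. A status packet is a valid update if it is delivered and, upon its reception, is fresher than every status packet received before. Let $N(T)$ be the number of valid updates delivered before time $T$. At time $0$ at least one of the two queues is empty; the number of stored status packets minus the number of stored energy packets is then an arbitrary integer $S_0\in\{-B,\dots,K\}$. Then, almost surely, every status packet that arrives after time $0$ is a valid update if and only if the battery is nonempty on its arrival or an energy packet arrives after it and before the next status packet. Moreover, almost surely, the valid-update rate $\tilde\lambda=\lim_{T\to\infty}N(T)/T$ exists and $$\tilde\lambda=\lambda\,\frac{(\theta^{-B}-1)(1+\theta)+(1-\theta^{K+1})}{(\theta^{-B}-\theta^{K+1})(1+\theta)}.$$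 -/

import Mathlib

open MeasureTheory ProbabilityTheory Filter Topology

noncomputable section

namespace EnergyStatus

/-- Inter-arrival times of a sequence of arrival times; the first one is counted from time `0`. -/
def gap {Ω : Type*} (A : ℕ → Ω → ℝ) : ℕ → Ω → ℝ
  | 0 => A 0
  | n + 1 => fun ω => A (n + 1) ω - A n ω

/-- `A 0, A 1, …` are the successive arrival times of a Poisson process of rate `rate` on
`(0, ∞)`: the inter-arrival times are independent and exponential with parameter `rate`. -/
structure IsPoissonArrivals {Ω : Type*} [MeasurableSpace Ω] (μ : Measure Ω) (rate : ℝ)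
    (A : ℕ → Ω → ℝ) : Prop where
  measurable : ∀ n, Measurable (A n)
  gap_law : ∀ n, μ.map (gap A n) = expMeasure rate
  gap_indep : iIndepFun (gap A) μ

/-- State of the transmitter and of the receiver. A status packet is named by an integer, in the
order of generation: `0, 1, 2, …` are the packets that arrive after time `0`, and the negative
integers name packets that were already stored at time `0`. A larger integer is a fresher packet. -/
structure SystemState where
  /-- number of status packets that have arrived since time `0` -/
  arrivals : ℕ
  /-- number of energy packets that have arrived since time `0` -/
  energy : ℕ
  /-- content of the data buffer, freshest packet first -/
  buffer : List ℤ
  /-- number of energy packets in the battery -/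
  battery : ℕ
  /-- packets received so far, with their reception times, last received packet first -/
  received : List (ℤ × ℝ)

/-- Service at time `t`, which takes no time and is work-conserving: as long as neither the
data buffer nor the battery is empty, the packet at the front of the buffer (LCFS: the freshest
one) is delivered to the receiver and one energy packet is consumed. -/
def serve (t : ℝ) : List ℤ → ℕ → List (ℤ × ℝ) → List ℤ × ℕ × List (ℤ × ℝ)
  | [], b, rec => ([], b, rec)
  | p :: buf, 0, rec => (p :: buf, 0, rec)
  | p :: buf, b + 1, rec => serve t buf b ((p, t) :: rec)

/-- A status packet arrives at time `t`: it joins the front of the data buffer of capacity `K`,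
the oldest packet being discarded if the buffer was full, and then service takes place. -/
def statusArrival (K : ℕ) (t : ℝ) (s : SystemState) : SystemState :=
  let out := serve t (((s.arrivals : ℤ) :: s.buffer).take K) s.battery s.received
  { arrivals := s.arrivals + 1
    energy := s.energy
    buffer := out.1
    battery := out.2.1
    received := out.2.2 }

/-- An energy packet arrives at time `t`: it is stored in the battery of capacity `B`, or discarded
if the battery is full, and then service takes place. -/
def energyArrival (B : ℕ) (t : ℝ) (s : SystemState) : SystemState :=
  let out := serve t s.buffer (min (s.battery + 1) B) s.received
  { arrivals := s.arrivals
    energy := s.energy + 1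
    buffer := out.1
    battery := out.2.1
    received := out.2.2 }

/-- State at time `0` given by `S = (data queue length) - (energy queue length)`. As service takes no
time, at least one of the two queues is empty: for `S ≥ 0` the packets `-1, …, -S` are stored and the
battery is empty, for `S ≤ 0` the data buffer is empty and the battery level is `-S`. -/
def initialState (S : ℤ) : SystemState where
  arrivals := 0
  energy := 0
  buffer := (List.range S.toNat).map fun i => -((i : ℤ) + 1)
  battery := (-S).toNat
  received := []

/-- The next event (arrival of a status packet or of an energy packet) is the earlier one of the next
status arrival and the next energy arrival; `a` and `e` are the two sequences of arrival times. -/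
def step (K B : ℕ) (a e : ℕ → ℝ) (s : SystemState) : SystemState :=
  if a s.arrivals < e s.energy then statusArrival K (a s.arrivals) s
  else energyArrival B (e s.energy) s

/-- State after the first `k` events. -/
def run (K B : ℕ) (S₀ : ℤ) (a e : ℕ → ℝ) : ℕ → SystemState
  | 0 => initialState S₀
  | k + 1 => step K B a e (run K B S₀ a e k)

/-- Packet `p` is a valid update, received at time `d`: it is delivered, and it is fresher than every
packet that the receiver has received before it. -/
def IsValidUpdateAt (K B : ℕ) (S₀ : ℤ) (a e : ℕ → ℝ) (p : ℤ) (d : ℝ) : Prop :=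
  ∃ (k : ℕ) (before : List (ℤ × ℝ)),
    (p, d) :: before <:+ (run K B S₀ a e k).received ∧ ∀ x ∈ before, x.1 < p

/-- Packet `p` is a valid update. -/
def IsValidUpdate (K B : ℕ) (S₀ : ℤ) (a e : ℕ → ℝ) (p : ℤ) : Prop :=
  ∃ d, IsValidUpdateAt K B S₀ a e p d

/-- The battery is nonempty just before the arrival of status packet `n`. -/
def BatteryNonemptyOnArrival (K B : ℕ) (S₀ : ℤ) (a e : ℕ → ℝ) (n : ℕ) : Prop :=
  ∃ k, (run K B S₀ a e k).arrivals = n ∧ a n < e (run K B S₀ a e k).energy ∧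
    0 < (run K B S₀ a e k).battery

/-- Number of valid updates delivered before time `T`. -/
def validUpdateCount (K B : ℕ) (S₀ : ℤ) (a e : ℕ → ℝ) (T : ℝ) : ℕ :=
  Set.ncard {p : ℤ | ∃ d < T, IsValidUpdateAt K B S₀ a e p d}

end EnergyStatus

end

/-! Which packets are served depends only on the order of the events, that is, on their types
(status or energy). By loss of memory, the type of the first event is independent of the residual
gaps after it, and these have the original law (`map_firstType_residual`). Hence the types are
independent coin tosses with `p = lam / (lam + r)`, and the net level (data queue minus battery) is
a random walk on the levels from `-B` to `K`, blocked at both ends.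

Validity is a pathwise fact. A packet that meets a nonempty battery is sent at once. Otherwise it
waits at the front of the buffer. If the next event is an energy arrival, it is sent while
everything received before is older. If the next event is a status arrival, a fresher packet is from
then on ahead of it, so it is overtaken or lost; the invariant `Stale` records this.

The rate comes from long-run frequencies along a path. Letters centred at `p` and weighted by a
bounded function of the past are martingale differences; a second-moment bound along the squares
gives their law of large numbers (`ae_tendsto_weightedSum_div`). Up- and down-crossings between
neighbouring levels alternate, so the level frequencies satisfy `p * f x = (1 - p) * f (x + 1)` in
the limit: they are geometric with ratio `θ = p / (1 - p)` and sum to one. If `π` is the limiting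
frequency of the negative levels, the served fraction of status packets is `π + (1 - π) * (1 - p)`,
and the geometric sums give the closed form. The strong law for the arrival times converts this
fraction per packet into a rate per unit of time; packets stored at time `0` change the count by a
bounded amount. -/

namespace EnergyStatus

open scoped ENNReal

/-! ### Independent sequences and competing exponential clocks -/

/-- The sequence with a given head and a given tail. -/
def consSeq (h : ℝ) (t : ℕ → ℝ) : ℕ → ℝ
  | 0 => h
  | n + 1 => t n

lemma measurable_consSeq : Measurable fun p : ℝ × (ℕ → ℝ) => consSeq p.1 p.2 := by
  refine measurable_pi_lambda _ fun n => ?_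
  cases n with
  | zero => exact measurable_fst
  | succ n => exact (measurable_pi_apply n).comp measurable_snd

/-- Splits an i.i.d. sequence into its first term and the rest, so that the clocks deciding the
first event can be integrated apart from the later gaps. -/
lemma map_consSeq_infinitePi (ν : Measure ℝ) [IsProbabilityMeasure ν] :
    (ν.prod (Measure.infinitePi fun _ : ℕ => ν)).map (fun p => consSeq p.1 p.2) =
      Measure.infinitePi fun _ : ℕ => ν := by
  classical
  refine Measure.eq_infinitePi _ fun s t ht => ?_
  -- Padding the rectangle with full sides up to an initial segment makes index `0` always present,
  -- so the head splits off uniformly.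
  obtain ⟨N, hN⟩ : ∃ N, s ⊆ Finset.range (N + 1) :=
    ⟨s.sup id, fun i hi => by simpa [Nat.lt_succ_iff] using Finset.le_sup (f := id) hi⟩
  set t' : ℕ → Set ℝ := fun i => if i ∈ s then t i else Set.univ with ht'
  have hm : ∀ i, MeasurableSet (t' i) := fun i => by
    by_cases hi : i ∈ s
    · simpa [ht', hi] using ht i
    · simp [ht', hi]
  have hset : Set.pi (s : Set ℕ) t = Set.pi (Finset.range (N + 1) : Set ℕ) t' := by
    ext x
    simp only [Set.mem_pi, Finset.mem_coe]
    refine ⟨fun h i _ => ?_, fun h i hi => ?_⟩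
    · by_cases hi : i ∈ s
      · simpa [ht', hi] using h i hi
      · simp [ht', hi]
    · simpa [ht', hi] using h i (hN hi)
  have hprod : ∏ i ∈ s, ν (t i) = ∏ i ∈ Finset.range (N + 1), ν (t' i) := by
    rw [← Finset.prod_subset hN]
    · exact Finset.prod_congr rfl fun i hi => by simp [ht', hi]
    · intro i _ hi
      simp [ht', hi]
  have hpre : (fun p : ℝ × (ℕ → ℝ) => consSeq p.1 p.2) ⁻¹'
      Set.pi (Finset.range (N + 1) : Set ℕ) t' =
      t' 0 ×ˢ Set.pi (Finset.range N : Set ℕ) (fun i => t' (i + 1)) := by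
    ext ⟨h, x⟩
    simp only [Set.mem_preimage, Set.mem_pi, Finset.coe_range, Set.mem_Iio, Set.mem_prod]
    refine ⟨fun H => ⟨H 0 (by omega), fun i hi => H (i + 1) (by omega)⟩, fun H i hi => ?_⟩
    cases i with
    | zero => exact H.1
    | succ i => exact H.2 i (by omega)
  rw [hset, hprod, Measure.map_apply measurable_consSeq
    (MeasurableSet.pi (Finset.countable_toSet _) fun i _ => hm i), hpre, Measure.prod_prod,
    Measure.infinitePi_pi _ fun i _ => hm (i + 1), Finset.prod_range_succ', mul_comm]

lemma expMeasure_eq_withDensity (r : ℝ) :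
    expMeasure r = volume.withDensity (exponentialPDF r) := rfl

lemma measurable_exponentialPDF (r : ℝ) : Measurable (exponentialPDF r) :=
  (measurable_exponentialPDFReal r).ennreal_ofReal

instance nullSingletonClass_expMeasure (r : ℝ) : NullSingletonClass (expMeasure r) where
  measure_singleton x := by
    rw [expMeasure_eq_withDensity]
    exact withDensity_absolutelyContinuous _ _ (measure_singleton x)

lemma lintegral_expMeasure (r : ℝ) (g : ℝ → ℝ≥0∞) (hg : Measurable g) :
    ∫⁻ x, g x ∂(expMeasure r) = ∫⁻ x, exponentialPDF r x * g x := by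
  rw [expMeasure_eq_withDensity,
    lintegral_withDensity_eq_lintegral_mul _ (measurable_exponentialPDF r) hg]
  rfl

lemma ae_nonneg_expMeasure (r : ℝ) : ∀ᵐ x ∂(expMeasure r), 0 ≤ x := by
  rw [expMeasure_eq_withDensity, ae_withDensity_iff (measurable_exponentialPDF r)]
  refine ae_of_all _ fun x hx => ?_
  by_contra h
  exact hx (exponentialPDF_of_neg (not_le.1 h))

lemma ae_pos_expMeasure (r : ℝ) : ∀ᵐ x ∂(expMeasure r), 0 < x := by
  have h0 : ∀ᵐ x ∂(expMeasure r), x ≠ 0 := by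
    simp [ae_iff]
  filter_upwards [ae_nonneg_expMeasure r, h0] with x h1 h2
  exact lt_of_le_of_ne h1 h2.symm

/-- Loss of memory of the exponential distribution. -/
lemma lintegral_expMeasure_indicator_le {r : ℝ} {x : ℝ} (hx : 0 ≤ x)
    (g : ℝ → ℝ≥0∞) (hg : Measurable g) :
    ∫⁻ y, (Set.Ici x).indicator (fun y => g (y - x)) y ∂(expMeasure r) =
      ENNReal.ofReal (Real.exp (-(r * x))) * ∫⁻ u, g u ∂(expMeasure r) := by
  have hm : Measurable ((Set.Ici x).indicator fun y => g (y - x)) :=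
    (hg.comp (measurable_id.sub_const x)).indicator measurableSet_Ici
  rw [lintegral_expMeasure _ _ hm, lintegral_expMeasure _ _ hg, ← lintegral_const_mul' _ _
    ENNReal.ofReal_ne_top, ← lintegral_add_right_eq_self _ x]
  refine lintegral_congr fun u => ?_
  by_cases hu : 0 ≤ u
  · rw [Set.indicator_of_mem (by simpa using hu), exponentialPDF_of_nonneg hu,
      exponentialPDF_of_nonneg (by linarith), add_sub_cancel_right, ← mul_assoc,
      ← ENNReal.ofReal_mul (Real.exp_nonneg _)]
    congr 2
    rw [show -(r * (u + x)) = -(r * x) + -(r * u) by ring, Real.exp_add]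
    ring
  · rw [Set.indicator_of_notMem (by simpa using hu), exponentialPDF_of_neg (not_le.1 hu)]
    simp

/-- The law has no atoms, so the strict and weak versions agree. Both are used, because a tie is
counted as an energy event. -/
lemma lintegral_expMeasure_indicator_lt {r : ℝ} {x : ℝ} (hx : 0 ≤ x)
    (g : ℝ → ℝ≥0∞) (hg : Measurable g) :
    ∫⁻ y, (Set.Ioi x).indicator (fun y => g (y - x)) y ∂(expMeasure r) =
      ENNReal.ofReal (Real.exp (-(r * x))) * ∫⁻ u, g u ∂(expMeasure r) := by
  rw [← lintegral_expMeasure_indicator_le hx g hg]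
  refine lintegral_congr_ae ?_
  exact indicator_ae_eq_of_ae_eq_set Ioi_ae_eq_Ici

/-- The integrand times the density of rate `l` is a multiple of the density of rate `l + r`, the
law of the minimum of the clocks. The value is the probability that the `l`-clock rings first. -/
lemma lintegral_exp_neg_expMeasure {l r : ℝ} (hl : 0 < l) (hr : 0 < r) :
    ∫⁻ x, ENNReal.ofReal (Real.exp (-(r * x))) ∂(expMeasure l) = ENNReal.ofReal (l / (l + r)) := by
  have hm : Measurable fun x : ℝ => ENNReal.ofReal (Real.exp (-(r * x))) := by fun_prop
  rw [lintegral_expMeasure _ _ hm]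
  have : ∀ x, exponentialPDF l x * ENNReal.ofReal (Real.exp (-(r * x))) =
      ENNReal.ofReal (l / (l + r)) * exponentialPDF (l + r) x := by
    intro x
    by_cases hx : 0 ≤ x
    · rw [exponentialPDF_of_nonneg hx, exponentialPDF_of_nonneg hx,
        ← ENNReal.ofReal_mul (by positivity), ← ENNReal.ofReal_mul (by positivity)]
      congr 1
      rw [show -((l + r) * x) = -(l * x) + -(r * x) by ring, Real.exp_add]
      field_simp
    · rw [exponentialPDF_of_neg (not_le.1 hx), exponentialPDF_of_neg (not_le.1 hx)]
      simp
  simp_rw [this]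
  rw [lintegral_const_mul _ (measurable_exponentialPDF _),
    lintegral_exponentialPDF_eq_one (by positivity), mul_one]

/-- Competition of two independent exponential clocks: the excess of the later one over the earlier
one is exponential. -/
lemma lintegral_lintegral_expMeasure_lt {l r : ℝ} (hl : 0 < l) (hr : 0 < r)
    (g : ℝ → ℝ≥0∞) (hg : Measurable g) :
    ∫⁻ x, ∫⁻ y, (Set.Ioi x).indicator (fun y => g (y - x)) y ∂(expMeasure r) ∂(expMeasure l) =
      ENNReal.ofReal (l / (l + r)) * ∫⁻ u, g u ∂(expMeasure r) := by
  rw [← lintegral_exp_neg_expMeasure hl hr, ← lintegral_mul_const _ (by fun_prop)]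
  refine lintegral_congr_ae ?_
  filter_upwards [ae_nonneg_expMeasure l] with x hx
  exact lintegral_expMeasure_indicator_lt hx g hg

lemma lintegral_lintegral_expMeasure_le {l r : ℝ} (hl : 0 < l) (hr : 0 < r)
    (g : ℝ → ℝ≥0∞) (hg : Measurable g) :
    ∫⁻ x, ∫⁻ y, (Set.Ici x).indicator (fun y => g (y - x)) y ∂(expMeasure r) ∂(expMeasure l) =
      ENNReal.ofReal (l / (l + r)) * ∫⁻ u, g u ∂(expMeasure r) := by
  rw [← lintegral_exp_neg_expMeasure hl hr, ← lintegral_mul_const _ (by fun_prop)]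
  refine lintegral_congr_ae ?_
  filter_upwards [ae_nonneg_expMeasure l] with x hx
  exact lintegral_expMeasure_indicator_le hx g hg

/-! ### Two Poisson processes seen from the first event -/

/-- Law of the sequence of gaps of a Poisson process. -/
noncomputable def gapLaw (r : ℝ) : Measure (ℕ → ℝ) := Measure.infinitePi fun _ : ℕ => expMeasure r

/-- Law of the gaps of two independent Poisson processes. -/
noncomputable def gapsLaw (l r : ℝ) : Measure ((ℕ → ℝ) × (ℕ → ℝ)) := (gapLaw l).prod (gapLaw r)

/-- Law of the type of an event, `true` standing for status packets. -/
noncomputable def typeLaw (l r : ℝ) : Measure Bool :=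
  ENNReal.ofReal (l / (l + r)) • Measure.dirac true +
    ENNReal.ofReal (r / (l + r)) • Measure.dirac false

/-- Type of the first event of two processes with given gaps. -/
noncomputable def firstType (z : (ℕ → ℝ) × (ℕ → ℝ)) : Bool := decide (z.1 0 < z.2 0)

/-- Gaps of two processes as seen just after the first event. -/
noncomputable def residual (z : (ℕ → ℝ) × (ℕ → ℝ)) : (ℕ → ℝ) × (ℕ → ℝ) :=
  if z.1 0 < z.2 0 then (fun n => z.1 (n + 1), consSeq (z.2 0 - z.1 0) fun n => z.2 (n + 1))
  else (consSeq (z.1 0 - z.2 0) fun n => z.1 (n + 1), fun n => z.2 (n + 1))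

lemma measurableSet_first_lt :
    MeasurableSet {z : (ℕ → ℝ) × (ℕ → ℝ) | z.1 0 < z.2 0} :=
  measurableSet_lt ((measurable_pi_apply 0).comp measurable_fst)
    ((measurable_pi_apply 0).comp measurable_snd)

lemma measurable_firstType : Measurable firstType :=
  measurable_to_bool (by
    convert measurableSet_first_lt using 1
    ext z
    simp [firstType])

lemma measurable_consSeq_comp {α : Type*} [MeasurableSpace α] {f : α → ℝ} {g : α → ℕ → ℝ}
    (hf : Measurable f) (hg : Measurable g) : Measurable fun a => consSeq (f a) (g a) :=
  measurable_consSeq.comp (hf.prodMk hg)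

lemma measurable_residual : Measurable residual := by
  have h1 : ∀ n, Measurable fun z : (ℕ → ℝ) × (ℕ → ℝ) => z.1 n := fun n =>
    (measurable_pi_apply n).comp measurable_fst
  have h2 : ∀ n, Measurable fun z : (ℕ → ℝ) × (ℕ → ℝ) => z.2 n := fun n =>
    (measurable_pi_apply n).comp measurable_snd
  exact Measurable.ite measurableSet_first_lt
    ((measurable_pi_lambda _ fun n => h1 (n + 1)).prodMk
      (measurable_consSeq_comp ((h2 0).sub (h1 0)) (measurable_pi_lambda _ fun n => h2 (n + 1))))
    ((measurable_consSeq_comp ((h1 0).sub (h2 0))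
      (measurable_pi_lambda _ fun n => h1 (n + 1))).prodMk
        (measurable_pi_lambda _ fun n => h2 (n + 1)))

lemma isProbabilityMeasure_gapLaw {r : ℝ} (hr : 0 < r) : IsProbabilityMeasure (gapLaw r) := by
  have := isProbabilityMeasure_expMeasure hr
  unfold gapLaw
  infer_instance

lemma isProbabilityMeasure_gapsLaw {l r : ℝ} (hl : 0 < l) (hr : 0 < r) :
    IsProbabilityMeasure (gapsLaw l r) := by
  have := isProbabilityMeasure_gapLaw hr
  have := isProbabilityMeasure_gapLaw hl
  unfold gapsLaw
  infer_instance

lemma isProbabilityMeasure_typeLaw {l r : ℝ} (hl : 0 < l) (hr : 0 < r) :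
    IsProbabilityMeasure (typeLaw l r) where
  measure_univ := by
    simp only [typeLaw, Measure.coe_add, Measure.coe_smul, Pi.add_apply, Pi.smul_apply,
      measure_univ, smul_eq_mul, mul_one]
    rw [← ENNReal.ofReal_add (by positivity) (by positivity), ← add_div,
      div_self (by positivity), ENNReal.ofReal_one]

lemma lintegral_gapLaw {r : ℝ} (hr : 0 < r) (F : (ℕ → ℝ) → ℝ≥0∞) (hF : Measurable F) :
    ∫⁻ x, F x ∂(gapLaw r) = ∫⁻ t, ∫⁻ h, F (consSeq h t) ∂(expMeasure r) ∂(gapLaw r) := by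
  have := isProbabilityMeasure_expMeasure hr
  have := isProbabilityMeasure_gapLaw hr
  conv_lhs => rw [gapLaw, ← map_consSeq_infinitePi, lintegral_map hF measurable_consSeq]
  exact lintegral_prod_symm' _ (hF.comp measurable_consSeq)

lemma lintegral_gapsLaw_snd {l r : ℝ} (hl : 0 < l) (hr : 0 < r)
    (F : (ℕ → ℝ) × (ℕ → ℝ) → ℝ≥0∞) (hF : Measurable F) :
    ∫⁻ z, F z ∂(gapsLaw l r) =
      ∫⁻ s, ∫⁻ t, ∫⁻ u, F (s, consSeq u t) ∂(expMeasure r) ∂(gapLaw r) ∂(gapLaw l) := by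
  have := isProbabilityMeasure_gapLaw hr
  have := isProbabilityMeasure_gapLaw hl
  rw [gapsLaw, lintegral_prod _ hF.aemeasurable]
  exact lintegral_congr fun s => lintegral_gapLaw hr _ (hF.comp measurable_prodMk_left)

lemma lintegral_gapsLaw_fst {l r : ℝ} (hl : 0 < l) (hr : 0 < r)
    (F : (ℕ → ℝ) × (ℕ → ℝ) → ℝ≥0∞) (hF : Measurable F) :
    ∫⁻ z, F z ∂(gapsLaw l r) =
      ∫⁻ s, ∫⁻ t, ∫⁻ u, F (consSeq u s, t) ∂(expMeasure l) ∂(gapLaw r) ∂(gapLaw l) := by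
  have := isProbabilityMeasure_gapLaw hr
  have := isProbabilityMeasure_gapLaw hl
  have := isProbabilityMeasure_expMeasure hl
  rw [gapsLaw, lintegral_prod_symm' _ hF, lintegral_lintegral_swap
    (f := fun s t => ∫⁻ u, F (consSeq u s, t) ∂(expMeasure l))]
  · exact lintegral_congr fun t => lintegral_gapLaw hl _ (hF.comp measurable_prodMk_right)
  · refine Measurable.aemeasurable ?_
    refine Measurable.lintegral_prod_right' (f := fun p : ((ℕ → ℝ) × (ℕ → ℝ)) × ℝ =>
      F (consSeq p.2 p.1.1, p.1.2)) ?_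
    exact hF.comp ((measurable_consSeq_comp measurable_snd measurable_fst.fst).prodMk
      measurable_fst.snd)

lemma lintegral_gapsLaw {l r : ℝ} (hl : 0 < l) (hr : 0 < r)
    (F : (ℕ → ℝ) × (ℕ → ℝ) → ℝ≥0∞) (hF : Measurable F) :
    ∫⁻ z, F z ∂(gapsLaw l r) =
      ∫⁻ s, ∫⁻ t, ∫⁻ x, ∫⁻ y, F (consSeq x s, consSeq y t)
        ∂(expMeasure r) ∂(expMeasure l) ∂(gapLaw r) ∂(gapLaw l) := by
  have := isProbabilityMeasure_gapLaw hr
  have := isProbabilityMeasure_gapLaw hl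
  have := isProbabilityMeasure_expMeasure hl
  have := isProbabilityMeasure_expMeasure hr
  have hG : ∀ s, Measurable fun p : (ℕ → ℝ) × ℝ =>
      ∫⁻ y, F (consSeq p.2 s, consSeq y p.1) ∂(expMeasure r) := fun s =>
    Measurable.lintegral_prod_right' (f := fun p : ((ℕ → ℝ) × ℝ) × ℝ =>
      F (consSeq p.1.2 s, consSeq p.2 p.1.1))
      (hF.comp ((measurable_consSeq_comp measurable_fst.snd measurable_const).prodMk
        (measurable_consSeq_comp measurable_snd measurable_fst.fst)))
  rw [gapsLaw, lintegral_prod _ hF.aemeasurable,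
    lintegral_gapLaw hl _ (Measurable.lintegral_prod_right' (f := F) hF)]
  refine lintegral_congr fun s => ?_
  rw [lintegral_lintegral_swap (f := fun t x => ∫⁻ y, F (consSeq x s, consSeq y t) ∂(expMeasure r))
    (hG s).aemeasurable]
  exact lintegral_congr fun x => lintegral_gapLaw hr _ (hF.comp measurable_prodMk_left)

lemma lintegral_typeLaw_prod {l r : ℝ} {β : Type*} [MeasurableSpace β] (ν : Measure β) [SFinite ν]
    (f : Bool × β → ℝ≥0∞) (hf : Measurable f) :
    ∫⁻ w, f w ∂((typeLaw l r).prod ν) =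
      ENNReal.ofReal (l / (l + r)) * ∫⁻ z, f (true, z) ∂ν +
        ENNReal.ofReal (r / (l + r)) * ∫⁻ z, f (false, z) ∂ν := by
  have : SFinite (typeLaw l r) := by unfold typeLaw; infer_instance
  rw [lintegral_prod _ hf.aemeasurable, typeLaw, lintegral_add_measure, lintegral_smul_measure,
    lintegral_smul_measure, lintegral_dirac, lintegral_dirac]
  rfl

/-- The type of the first event is independent of the processes as seen just after the first event,
which are again independent Poisson processes. -/
theorem map_firstType_residual {l r : ℝ} (hl : 0 < l) (hr : 0 < r) :
    (gapsLaw l r).map (fun z => (firstType z, residual z)) =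
      (typeLaw l r).prod (gapsLaw l r) := by
  have := isProbabilityMeasure_gapsLaw hl hr
  have := isProbabilityMeasure_gapLaw hr
  have := isProbabilityMeasure_gapLaw hl
  have := isProbabilityMeasure_expMeasure hl
  have := isProbabilityMeasure_expMeasure hr
  have hm := measurable_firstType.prodMk measurable_residual
  refine Measure.ext_of_lintegral _ fun f hf => ?_
  rw [lintegral_map hf hm,
    lintegral_gapsLaw hl hr (fun z => f (firstType z, residual z)) (hf.comp hm), lintegral_typeLaw_prod _ _ hf,
    lintegral_gapsLaw_snd hl hr (fun z => f (true, z)) (hf.comp measurable_prodMk_left),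
    lintegral_gapsLaw_fst hl hr (fun z => f (false, z)) (hf.comp measurable_prodMk_left)]
  have ht : Measurable fun p : ((ℕ → ℝ) × (ℕ → ℝ)) × ℝ => f (true, p.1.1, consSeq p.2 p.1.2) :=
    hf.comp (measurable_const.prodMk (measurable_fst.fst.prodMk
      (measurable_consSeq_comp measurable_snd measurable_fst.snd)))
  have hft : Measurable fun p : ((ℕ → ℝ) × (ℕ → ℝ)) × ℝ => f (false, consSeq p.2 p.1.1, p.1.2) :=
    hf.comp (measurable_const.prodMk
      ((measurable_consSeq_comp measurable_snd measurable_fst.fst).prodMk measurable_fst.snd))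
  have hM : Measurable fun p : (ℕ → ℝ) × (ℕ → ℝ) =>
      ∫⁻ u, f (true, p.1, consSeq u p.2) ∂(expMeasure r) := ht.lintegral_prod_right'
  have hM' : Measurable fun p : (ℕ → ℝ) × (ℕ → ℝ) =>
      ∫⁻ u, f (false, consSeq u p.1, p.2) ∂(expMeasure l) := hft.lintegral_prod_right'
  rw [← lintegral_const_mul' _ _ ENNReal.ofReal_ne_top,
    ← lintegral_const_mul' _ _ ENNReal.ofReal_ne_top, ← lintegral_add_left]
  · refine lintegral_congr fun s => ?_
    rw [← lintegral_const_mul' _ _ ENNReal.ofReal_ne_top,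
      ← lintegral_const_mul' _ _ ENNReal.ofReal_ne_top, ← lintegral_add_left]
    · refine lintegral_congr fun t => ?_
      have hg : Measurable fun u => f (true, s, consSeq u t) :=
        ht.comp (measurable_prodMk_left (x := (s, t)))
      have hg' : Measurable fun u => f (false, consSeq u s, t) :=
        hft.comp (measurable_prodMk_left (x := (s, t)))
      rw [← lintegral_lintegral_expMeasure_lt hl hr _ hg, add_comm l r,
        ← lintegral_lintegral_expMeasure_le hr hl _ hg']
      have e1 : Measurable fun p : ℝ × ℝ =>
          (Set.Ioi p.1).indicator (fun y => f (true, s, consSeq (y - p.1) t)) p.2 :=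
        Measurable.indicator (s := {p : ℝ × ℝ | p.1 < p.2})
          (f := fun p : ℝ × ℝ => f (true, s, consSeq (p.2 - p.1) t))
          (hg.comp (measurable_snd.sub measurable_fst))
          (measurableSet_lt measurable_fst measurable_snd)
      have e2 : Measurable fun p : ℝ × ℝ =>
          (Set.Ici p.2).indicator (fun x => f (false, consSeq (x - p.2) s, t)) p.1 :=
        Measurable.indicator (s := {p : ℝ × ℝ | p.2 ≤ p.1})
          (f := fun p : ℝ × ℝ => f (false, consSeq (p.1 - p.2) s, t))
          (hg'.comp (measurable_fst.sub measurable_snd))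
          (measurableSet_le measurable_snd measurable_fst)
      -- The energy-first term has the energy clock as its outer variable; the swap brings both
      -- terms to one order of integration so that they can be merged.
      rw [lintegral_lintegral_swap (f := fun y x => (Set.Ici y).indicator
        (fun x => f (false, consSeq (x - y) s, t)) x) (e2.comp measurable_swap).aemeasurable,
        ← lintegral_add_left e1.lintegral_prod_right']
      refine lintegral_congr fun x => ?_
      refine Eq.trans ?_ (lintegral_add_left (e1.comp (measurable_prodMk_left (x := x))) _)
      refine lintegral_congr fun y => ?_
      -- Exactly one of the two indicators is nonzero, the tie belonging to the energy-first one.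
      by_cases hxy : x < y
      · simp [firstType, residual, consSeq, hxy]
      · simp [firstType, residual, consSeq, hxy, not_lt.1 hxy]
    · exact (hM.comp measurable_prodMk_left).const_mul _
  · exact (hM.lintegral_prod_right').const_mul _

/-! ### Automata driven by independent letters -/

/-- Trajectory of an automaton with transition function `f` that reads the letters of `c`. -/
def drive {α : Type*} (f : α → Bool → α) (s : α) (c : ℕ → Bool) : ℕ → α
  | 0 => s
  | k + 1 => f (drive f s c k) (c k)

section Skew

variable {α Z : Type*} [MeasurableSpace α] [MeasurableSpace Z]

lemma measurable_drive {f : α → Bool → α} (hf : Measurable (Function.uncurry f)) (s : α)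
    {c : Z → ℕ → Bool} (hc : ∀ k, Measurable fun z => c z k) (k : ℕ) :
    Measurable fun z => drive f s (c z) k := by
  induction k with
  | zero => exact measurable_const
  | succ k ih => exact hf.comp (ih.prodMk (hc k))

/-- If the first letter is independent of the shifted sequence and the shift preserves the law, the
state of an automaton after `k` letters is independent of the sequence shifted `k` times. -/
lemma exists_map_drive_iterate {P : Measure Z} [IsProbabilityMeasure P] {b : Measure Bool}
    [IsProbabilityMeasure b] {τ : Z → Bool} {σ : Z → Z} (hτ : Measurable τ) (hσ : Measurable σ)
    (hP : P.map (fun z => (τ z, σ z)) = b.prod P)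
    {f : α → Bool → α} (hf : Measurable (Function.uncurry f)) (s : α) (k : ℕ) :
    ∃ ν : Measure α, IsProbabilityMeasure ν ∧
      P.map (fun z => (drive f s (fun j => τ (σ^[j] z)) k, σ^[k] z)) = ν.prod P := by
  have hd : ∀ k, Measurable fun z => drive f s (fun j => τ (σ^[j] z)) k :=
    measurable_drive hf s fun k => hτ.comp (hσ.iterate k)
  induction k with
  | zero =>
    refine ⟨Measure.dirac s, inferInstance, ?_⟩
    rw [Measure.dirac_prod]
    rfl
  | succ k ih =>
    obtain ⟨ν, hν, h⟩ := ih
    -- The old state and the letter it reads are independent, so the new state has the image of the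
    -- product law under the transition.
    refine ⟨(ν.prod b).map (Function.uncurry f),
      Measure.isProbabilityMeasure_map hf.aemeasurable, ?_⟩
    have hp : Measurable fun z => (τ z, σ z) := hτ.prodMk hσ
    have hk : Measurable fun z => (drive f s (fun j => τ (σ^[j] z)) k, σ^[k] z) :=
      (hd k).prodMk (hσ.iterate k)
    -- The shifted sequence is split into its first letter and its own shift, then the letter is
    -- regrouped with the state that consumes it.
    calc P.map (fun z => (drive f s (fun j => τ (σ^[j] z)) (k + 1), σ^[k + 1] z))
        = P.map ((Prod.map (Function.uncurry f) id ∘ MeasurableEquiv.prodAssoc.symm) ∘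
            (Prod.map id (fun z => (τ z, σ z))) ∘
            fun z => (drive f s (fun j => τ (σ^[j] z)) k, σ^[k] z)) := by
          congr 1
          funext z
          simp [drive, Function.iterate_succ_apply', MeasurableEquiv.prodAssoc]
      _ = ((ν.prod b).map (Function.uncurry f)).prod P := by
          rw [← Measure.map_map (((hf.prodMap measurable_id)).comp
              (MeasurableEquiv.measurable _)) ((measurable_id.prodMap hp).comp hk),
            ← Measure.map_map (measurable_id.prodMap hp) hk, h,
            ← Measure.map_prod_map _ _ measurable_id hp, Measure.map_id, hP,
            ← Measure.map_map (hf.prodMap measurable_id) (MeasurableEquiv.measurable _),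
            ((measurePreserving_prodAssoc ν b P).symm _).map_eq,
            ← Measure.map_prod_map _ _ hf measurable_id, Measure.map_id]

/-- The form used for orthogonality: a state is built from earlier letters only, hence is
independent of the letter it is about to read. -/
lemma exists_map_drive_type {P : Measure Z} [IsProbabilityMeasure P] {b : Measure Bool}
    [IsProbabilityMeasure b] {τ : Z → Bool} {σ : Z → Z} (hτ : Measurable τ) (hσ : Measurable σ)
    (hP : P.map (fun z => (τ z, σ z)) = b.prod P)
    {f : α → Bool → α} (hf : Measurable (Function.uncurry f)) (s : α) (k : ℕ) :
    ∃ ν : Measure α, IsProbabilityMeasure ν ∧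
      P.map (fun z => (drive f s (fun j => τ (σ^[j] z)) k, τ (σ^[k] z))) = ν.prod b := by
  obtain ⟨ν, hν, h⟩ := exists_map_drive_iterate hτ hσ hP hf s k
  refine ⟨ν, hν, ?_⟩
  have hd : ∀ k, Measurable fun z => drive f s (fun j => τ (σ^[j] z)) k :=
    measurable_drive hf s fun k => hτ.comp (hσ.iterate k)
  have hb : P.map τ = b := by
    have := congrArg (Measure.map Prod.fst) hP
    rw [Measure.map_map measurable_fst (hτ.prodMk hσ), Measure.map_fst_prod] at this
    rw [measure_univ, one_smul] at this
    exact this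
  have hk : Measurable fun z => (drive f s (fun j => τ (σ^[j] z)) k, σ^[k] z) :=
    (hd k).prodMk (hσ.iterate k)
  have : (fun z => (drive f s (fun j => τ (σ^[j] z)) k, τ (σ^[k] z))) =
      Prod.map id τ ∘ fun z => (drive f s (fun j => τ (σ^[j] z)) k, σ^[k] z) := rfl
  rw [this, ← Measure.map_map (measurable_id.prodMap hτ) hk, h,
    ← Measure.map_prod_map _ _ measurable_id hτ, Measure.map_id, hb]

end Skew

/-! ### Law of large numbers for weighted centred letters -/

/-- Centred indicator of the letter `true`. -/
noncomputable def centred (p : ℝ) (c : Bool) : ℝ := (if c then 1 else 0) - p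

lemma abs_centred_le {p : ℝ} (h0 : 0 ≤ p) (h1 : p ≤ 1) (c : Bool) : |centred p c| ≤ 1 := by
  cases c <;> simp [centred, abs_le] <;> constructor <;> linarith

lemma integral_centred {b : Measure Bool} [IsProbabilityMeasure b] {p : ℝ}
    (hp : b.real {true} = p) : ∫ c, centred p c ∂b = 0 := by
  have hu : b.real {true} + b.real {false} = 1 := by
    rw [← measureReal_union (by simp) (measurableSet_singleton _)]
    have : ({true} ∪ {false} : Set Bool) = Set.univ := by
      ext c; cases c <;> simp
    rw [this, probReal_univ]
  rw [integral_fintype (Integrable.of_finite)]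
  simp only [Fintype.sum_bool, centred, smul_eq_mul, hp, if_true, Bool.false_eq_true, if_false]
  rw [hp] at hu
  rw [show b.real {false} = 1 - p by linarith]
  ring

/-- Since `k ^ 2 ≤ n ≤ k ^ 2 + 2 * k` for `k = Nat.sqrt n`, the sequence moves by at most `2 * k`
after the last square, which is negligible against `k ^ 2`. -/
lemma tendsto_div_zero_of_squares {m : ℕ → ℝ} (hm : ∀ n, |m (n + 1) - m n| ≤ 1)
    (h : Tendsto (fun k : ℕ => m ((k + 1) ^ 2) / ((k + 1) ^ 2 : ℕ)) atTop (𝓝 0)) :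
    Tendsto (fun n => m n / n) atTop (𝓝 0) := by
  have hstep : ∀ n d : ℕ, |m (n + d) - m n| ≤ d := by
    intro n d
    induction d with
    | zero => simp
    | succ d ih =>
      have := abs_sub_le (m (n + (d + 1))) (m (n + d)) (m n)
      have h2 := hm (n + d)
      push_cast
      rw [← add_assoc] at *
      linarith
  have hs : Tendsto (fun n => Nat.sqrt n) atTop atTop := by
    refine tendsto_atTop.2 fun b => ?_
    filter_upwards [eventually_ge_atTop (b * b)] with n hn
    exact Nat.le_sqrt.2 hn
  have h' : Tendsto (fun k : ℕ => |m (k ^ 2) / (k ^ 2 : ℕ)| + 2 / (k : ℝ)) atTop (𝓝 0) := by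
    have h1 : Tendsto (fun k : ℕ => m (k ^ 2) / (k ^ 2 : ℕ)) atTop (𝓝 0) :=
      (tendsto_add_atTop_iff_nat (f := fun k : ℕ => m (k ^ 2) / (k ^ 2 : ℕ)) 1).1 h
    simpa using h1.abs.add (tendsto_const_div_atTop_nhds_zero_nat 2)
  refine squeeze_zero_norm' ?_ (h'.comp hs)
  filter_upwards [eventually_ge_atTop 1] with n hn
  set k := Nat.sqrt n with hk
  have hk1 : 1 ≤ k := Nat.le_sqrt.2 (by simpa using hn)
  have hkn : k ^ 2 ≤ n := Nat.sqrt_le' n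
  have hnk : n ≤ k ^ 2 + 2 * k := by
    have := Nat.sqrt_le_add n
    rw [sq]; rw [← hk] at this; omega
  clear_value k
  obtain ⟨d, rfl⟩ := Nat.exists_eq_add_of_le hkn
  have hd : (d : ℝ) ≤ 2 * k := by exact_mod_cast (by omega : d ≤ 2 * k)
  have hb : |m (k ^ 2 + d)| ≤ |m (k ^ 2)| + 2 * k := by
    have h1 := hstep (k ^ 2) d
    have h2 := abs_sub_abs_le_abs_sub (m (k ^ 2 + d)) (m (k ^ 2))
    linarith
  have hkp : (0 : ℝ) < k := by exact_mod_cast hk1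
  have hle : ((k ^ 2 : ℕ) : ℝ) ≤ ((k ^ 2 + d : ℕ) : ℝ) := by exact_mod_cast hkn
  simp only [Function.comp]
  rw [← hk, Real.norm_eq_abs, abs_div, abs_div, Nat.abs_cast, Nat.abs_cast]
  calc |m (k ^ 2 + d)| / ((k ^ 2 + d : ℕ) : ℝ)
      ≤ (|m (k ^ 2)| + 2 * k) / ((k ^ 2 : ℕ) : ℝ) := by
        have : (0 : ℝ) < ((k ^ 2 : ℕ) : ℝ) := by positivity
        gcongr
    _ = |m (k ^ 2)| / ((k ^ 2 : ℕ) : ℝ) + 2 / (k : ℝ) := by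
        push_cast
        field_simp

/-- Sum of the centred letters, weighted by a function of the state. -/
noncomputable def weightedSum {α : Type*} (f : α → Bool → α) (s : α) (v : α → ℝ) (p : ℝ) (c : ℕ → Bool)
    (n : ℕ) : ℝ :=
  ∑ j ∈ Finset.range n, v (drive f s c j) * centred p (c j)

/-- Adjoining the running sum to the state makes the sum itself independent of the next letter. -/
lemma drive_pair_weightedSum {α : Type*} (f : α → Bool → α) (s : α) (v : α → ℝ) (p : ℝ) (c : ℕ → Bool)
    (n : ℕ) :
    drive (fun (q : α × ℝ) x => (f q.1 x, q.2 + v q.1 * centred p x)) (s, 0) c n =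
      (drive f s c n, weightedSum f s v p c n) := by
  induction n with
  | zero => simp [drive, weightedSum]
  | succ n ih => simp [drive, ih, weightedSum, Finset.sum_range_succ]

lemma abs_weight_mul_centred_le {α : Type*} {v : α → ℝ} (hv1 : ∀ x, |v x| ≤ 1) {p : ℝ} (h0 : 0 ≤ p)
    (h1 : p ≤ 1) (x : α) (c : Bool) : |v x * centred p c| ≤ 1 := by
  rw [abs_mul]
  exact mul_le_one₀ (hv1 x) (abs_nonneg _) (abs_centred_le h0 h1 c)

lemma abs_weightedSum_le {α : Type*} (f : α → Bool → α) (s : α) {v : α → ℝ} (hv1 : ∀ x, |v x| ≤ 1) {p : ℝ}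
    (h0 : 0 ≤ p) (h1 : p ≤ 1) (c : ℕ → Bool) (n : ℕ) : |weightedSum f s v p c n| ≤ n := by
  refine (Finset.abs_sum_le_sum_abs _ _).trans ?_
  refine (Finset.sum_le_sum fun j _ => abs_weight_mul_centred_le hv1 h0 h1 _ (c j)).trans ?_
  simp

section Martingale

variable {α Z : Type*} [MeasurableSpace α] [MeasurableSpace Z]

/-- The increments are bounded martingale differences: on expanding the square the cross term
vanishes, and each step adds at most `1`. -/
lemma integral_weightedSum_sq_le {P : Measure Z} [IsProbabilityMeasure P] {b : Measure Bool}
    [IsProbabilityMeasure b] {τ : Z → Bool} {σ : Z → Z} (hτ : Measurable τ) (hσ : Measurable σ)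
    (hP : P.map (fun z => (τ z, σ z)) = b.prod P) {p : ℝ} (hp : b.real {true} = p)
    {f : α → Bool → α} (hf : Measurable (Function.uncurry f)) (s : α)
    {v : α → ℝ} (hv : Measurable v) (hv1 : ∀ x, |v x| ≤ 1) (n : ℕ) :
    Measurable (fun z => weightedSum f s v p (fun j => τ (σ^[j] z)) n) ∧
    ∫ z, weightedSum f s v p (fun j => τ (σ^[j] z)) n ^ 2 ∂P ≤ n := by
  have h0 : 0 ≤ p := hp ▸ measureReal_nonneg
  have h1 : p ≤ 1 := hp ▸ measureReal_le_one
  have hc : Measurable (centred p) := measurable_of_finite _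
  set F : α × ℝ → Bool → α × ℝ := fun q x => (f q.1 x, q.2 + v q.1 * centred p x) with hF
  have hFm : Measurable (Function.uncurry F) := by
    refine Measurable.prodMk (hf.comp (measurable_fst.fst.prodMk measurable_snd)) ?_
    exact measurable_fst.snd.add ((hv.comp measurable_fst.fst).mul (hc.comp measurable_snd))
  have hcm : ∀ j, Measurable fun z => τ (σ^[j] z) := fun j => hτ.comp (hσ.iterate j)
  have hSm : ∀ n, Measurable (fun z => weightedSum f s v p (fun j => τ (σ^[j] z)) n) := fun n => by
    have := (measurable_drive hFm (s, 0) hcm n).snd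
    simpa only [hF, drive_pair_weightedSum] using this
  refine ⟨hSm n, ?_⟩
  have hdm := measurable_drive hf s hcm
  induction n with
  | zero => simp [weightedSum]
  | succ n ih =>
    set M := fun z => weightedSum f s v p (fun j => τ (σ^[j] z)) n with hM
    set V := fun z => v (drive f s (fun j => τ (σ^[j] z)) n) with hV
    set D := fun z => centred p (τ (σ^[n] z)) with hD
    have hVm : Measurable V := hv.comp (hdm n)
    have hDm : Measurable D := hc.comp (hcm n)
    have hMb : ∀ z, |M z| ≤ n := fun z => abs_weightedSum_le f s hv1 h0 h1 _ n
    have hVD : ∀ z, |V z * D z| ≤ 1 := fun z => abs_weight_mul_centred_le hv1 h0 h1 _ _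
    -- `M` and `V` are functions of the state of the extended automaton, which is independent of the
    -- next letter, and the centred letter has mean zero.
    have hcross : ∫ z, M z * V z * D z ∂P = 0 := by
      obtain ⟨ν, hν, h⟩ := exists_map_drive_type hτ hσ hP hFm (s, 0) n
      have e : ∫ z, M z * V z * D z ∂P = ∫ w : (α × ℝ) × Bool, (w.1.2 * v w.1.1) * centred p w.2
          ∂(P.map (fun z => (drive F (s, 0) (fun j => τ (σ^[j] z)) n, τ (σ^[n] z)))) := by
        rw [integral_map]
        · simp only [hF, drive_pair_weightedSum]
          rfl
        · exact ((measurable_drive hFm (s, 0) hcm n).prodMk (hcm n)).aemeasurable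
        · exact ((measurable_fst.snd.mul (hv.comp measurable_fst.fst)).mul
            (hc.comp measurable_snd)).aestronglyMeasurable
      rw [e, h, integral_prod_mul (fun q : α × ℝ => q.2 * v q.1) (centred p), integral_centred hp,
        mul_zero]
    have i1 : Integrable (fun z => M z ^ 2) P := by
      refine Integrable.of_bound ((hSm n).pow_const 2).aestronglyMeasurable ((n : ℝ) ^ 2)
        (ae_of_all _ fun z => ?_)
      rw [Real.norm_eq_abs, abs_pow]
      exact pow_le_pow_left₀ (abs_nonneg _) (hMb z) 2
    have i2 : Integrable (fun z => 2 * (M z * V z * D z)) P := by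
      have hm : Measurable fun z => M z * V z * D z := ((hSm n).mul hVm).mul hDm
      refine Integrable.const_mul (Integrable.of_bound hm.aestronglyMeasurable (n : ℝ)
        (ae_of_all _ fun z => ?_)) 2
      rw [Real.norm_eq_abs, mul_assoc, abs_mul]
      calc |M z| * |V z * D z| ≤ n * 1 :=
            mul_le_mul (hMb z) (hVD z) (abs_nonneg _) (Nat.cast_nonneg _)
        _ = n := mul_one _
    have hsq : ∀ z, (V z * D z) ^ 2 ≤ 1 := fun z => by
      rw [← sq_abs]
      exact pow_le_one₀ (abs_nonneg _) (hVD z)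
    have i3 : Integrable (fun z => (V z * D z) ^ 2) P := by
      refine Integrable.of_bound ((hVm.mul hDm).pow_const 2).aestronglyMeasurable 1
        (ae_of_all _ fun z => ?_)
      rw [Real.norm_eq_abs, abs_of_nonneg (sq_nonneg _)]
      exact hsq z
    have hexp : ∀ z, weightedSum f s v p (fun j => τ (σ^[j] z)) (n + 1) ^ 2 =
        M z ^ 2 + 2 * (M z * V z * D z) + (V z * D z) ^ 2 := fun z => by
      simp only [weightedSum, Finset.sum_range_succ, hM, hV, hD]
      ring
    have h3 : ∫ z, (V z * D z) ^ 2 ∂P ≤ 1 := by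
      calc ∫ z, (V z * D z) ^ 2 ∂P ≤ ∫ _, (1 : ℝ) ∂P :=
            integral_mono i3 (integrable_const 1) hsq
        _ = 1 := by simp
    simp_rw [hexp]
    have i12 : Integrable (fun z => M z ^ 2 + 2 * (M z * V z * D z)) P := i1.add i2
    rw [integral_add i12 i3, integral_add i1 i2, integral_const_mul, hcross]
    push_cast
    linarith

/-- Law of large numbers for centred letters weighted by a bounded function of the past. -/
theorem ae_tendsto_weightedSum_div {P : Measure Z} [IsProbabilityMeasure P] {b : Measure Bool}
    [IsProbabilityMeasure b] {τ : Z → Bool} {σ : Z → Z} (hτ : Measurable τ) (hσ : Measurable σ)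
    (hP : P.map (fun z => (τ z, σ z)) = b.prod P) {p : ℝ} (hp : b.real {true} = p)
    {f : α → Bool → α} (hf : Measurable (Function.uncurry f)) (s : α)
    {v : α → ℝ} (hv : Measurable v) (hv1 : ∀ x, |v x| ≤ 1) :
    ∀ᵐ z ∂P, Tendsto (fun n : ℕ => weightedSum f s v p (fun j => τ (σ^[j] z)) n / n) atTop
      (𝓝 0) := by
  have h0 : 0 ≤ p := hp ▸ measureReal_nonneg
  have h1 : p ≤ 1 := hp ▸ measureReal_le_one
  have key := integral_weightedSum_sq_le hτ hσ hP hp hf s hv hv1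
  set W : ℕ → Z → ℝ := fun n z => weightedSum f s v p (fun j => τ (σ^[j] z)) n with hW
  set X : ℕ → Z → ℝ := fun k z => W ((k + 1) ^ 2) z / ((k + 1) ^ 2 : ℕ) with hX
  have hXm : ∀ k, Measurable (X k) := fun k => (key _).1.div_const _
  have hXint : ∀ k, ∫⁻ z, ENNReal.ofReal (X k z ^ 2) ∂P ≤
      ENNReal.ofReal (1 / ((k + 1 : ℕ) : ℝ) ^ 2) := fun k => by
    have hb : ∀ z, |X k z| ≤ 1 := fun z => by
      rw [hX]
      simp only
      rw [abs_div, Nat.abs_cast, div_le_one (by positivity)]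
      exact abs_weightedSum_le f s hv1 h0 h1 _ _
    rw [← ofReal_integral_eq_lintegral_ofReal]
    · refine ENNReal.ofReal_le_ofReal ?_
      simp only [hX, div_pow]
      rw [integral_div, div_le_div_iff₀ (by positivity) (by positivity)]
      have := (key ((k + 1) ^ 2)).2
      push_cast at this ⊢
      nlinarith [sq_nonneg ((k : ℝ) + 1)]
    · refine Integrable.of_bound ((hXm k).pow_const 2).aestronglyMeasurable 1
        (ae_of_all _ fun z => ?_)
      rw [Real.norm_eq_abs, abs_pow]
      exact pow_le_one₀ (abs_nonneg _) (hb z)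
    · exact ae_of_all _ fun z => sq_nonneg _
  -- The normalised second moments along the squares are at most `1 / (k + 1) ^ 2`. So `∑ X k ^ 2`
  -- has finite expectation, is almost surely finite, and its terms tend to zero.
  have hsum : ∫⁻ z, ∑' k, ENNReal.ofReal (X k z ^ 2) ∂P ≠ ∞ := by
    rw [lintegral_tsum fun k => ((hXm k).pow_const 2).ennreal_ofReal.aemeasurable]
    refine ne_top_of_le_ne_top ?_ (ENNReal.tsum_le_tsum hXint)
    refine Summable.tsum_ofReal_ne_top ?_
    exact (summable_nat_add_iff (f := fun n : ℕ => 1 / (n : ℝ) ^ 2) 1).2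
      (Real.summable_one_div_nat_pow.2 one_lt_two)
  have hae := ae_lt_top
    (Measurable.tsum fun k => ((hXm k).pow_const 2).ennreal_ofReal) hsum
  filter_upwards [hae] with z hz
  refine tendsto_div_zero_of_squares (fun n => ?_) ?_
  · simp only [weightedSum, Finset.sum_range_succ, add_sub_cancel_left]
    exact abs_weight_mul_centred_le hv1 h0 h1 _ _
  · have ht := ENNReal.tendsto_atTop_zero_of_tsum_ne_top hz.ne
    rw [← ENNReal.tendsto_toReal_zero_iff fun _ => ENNReal.ofReal_ne_top] at ht
    simp only [ENNReal.toReal_ofReal (sq_nonneg _)] at ht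
    have := ht.sqrt
    simp only [Real.sqrt_sq_eq_abs, Real.sqrt_zero] at this
    exact (tendsto_zero_iff_abs_tendsto_zero _).2 this

end Martingale

/-! ### Invariants of the system and evolution of the net level -/

/-- Data queue length minus energy queue length. -/
def netLevel (s : SystemState) : ℤ := (s.buffer.length : ℤ) - s.battery

/-- Type of the next event, `true` standing for status packets. -/
noncomputable def nextType (a e : ℕ → ℝ) (s : SystemState) : Bool :=
  decide (a s.arrivals < e s.energy)

/-- Facts that hold in every state reached by the system. -/
structure Reachable (K B : ℕ) (S₀ : ℤ) (a e : ℕ → ℝ) (s : SystemState) : Prop where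
  empty : s.buffer = [] ∨ s.battery = 0
  length_le : s.buffer.length ≤ K
  battery_le : s.battery ≤ B
  sorted : s.buffer.Pairwise (· > ·)
  buffer_lt : ∀ p ∈ s.buffer, p < s.arrivals
  buffer_ge : ∀ p ∈ s.buffer, -(S₀.toNat : ℤ) ≤ p
  received_lt : ∀ x ∈ s.received, x.1 < s.arrivals
  received_ge : ∀ x ∈ s.received, -(S₀.toNat : ℤ) ≤ x.1
  received_time : ∀ x ∈ s.received, ∀ n : ℕ, x.1 = n → a n ≤ x.2
  past_status : ∀ i < s.arrivals, a i ≤ e s.energy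
  past_energy : ∀ j < s.energy, e j ≤ a s.arrivals

lemma statusArrival_of_battery_eq_zero (K : ℕ) (t : ℝ) {s : SystemState} (h : s.battery = 0) :
    statusArrival K t s = ⟨s.arrivals + 1, s.energy, ((s.arrivals : ℤ) :: s.buffer).take K, 0,
      s.received⟩ := by
  have : ∀ l : List ℤ, serve t l 0 s.received = (l, 0, s.received) := by
    intro l
    cases l <;> rfl
  simp [statusArrival, h, this]

lemma statusArrival_of_buffer_eq_nil {K : ℕ} (hK : 1 ≤ K) (t : ℝ) {s : SystemState} {b : ℕ}
    (hb : s.battery = b + 1) (h : s.buffer = []) :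
    statusArrival K t s = ⟨s.arrivals + 1, s.energy, [], b, ((s.arrivals : ℤ), t) :: s.received⟩ := by
  obtain ⟨K, rfl⟩ := Nat.exists_eq_add_of_le' hK
  simp [statusArrival, hb, h, serve]

lemma energyArrival_of_buffer_eq_nil (B : ℕ) (t : ℝ) {s : SystemState} (h : s.buffer = []) :
    energyArrival B t s = ⟨s.arrivals, s.energy + 1, [], min (s.battery + 1) B, s.received⟩ := by
  simp [energyArrival, h, serve]

lemma energyArrival_of_buffer_eq_cons {B : ℕ} (hB : 1 ≤ B) (t : ℝ) {s : SystemState} {p : ℤ}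
    {l : List ℤ} (hb : s.battery = 0) (h : s.buffer = p :: l) :
    energyArrival B t s = ⟨s.arrivals, s.energy + 1, l, 0, (p, t) :: s.received⟩ := by
  have : ∀ r, serve t l 0 r = (l, 0, r) := by
    intro r
    cases l <;> rfl
  simp [energyArrival, h, hb, min_eq_left hB, serve, this]

lemma step_of_nextType_true {K B : ℕ} {a e : ℕ → ℝ} {s : SystemState}
    (h : nextType a e s = true) : step K B a e s = statusArrival K (a s.arrivals) s :=
  if_pos (by simpa [nextType] using h)

lemma step_of_nextType_false {K B : ℕ} {a e : ℕ → ℝ} {s : SystemState}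
    (h : nextType a e s = false) : step K B a e s = energyArrival B (e s.energy) s :=
  if_neg (by simpa [nextType] using h)

/-- The possible transitions from a state in which at least one of the queues is empty. -/
lemma step_cases {K B : ℕ} (hK : 1 ≤ K) (hB : 1 ≤ B) (a e : ℕ → ℝ) {s : SystemState}
    (hs : s.buffer = [] ∨ s.battery = 0) :
    (nextType a e s = true ∧ s.battery = 0 ∧ step K B a e s = ⟨s.arrivals + 1, s.energy,
      ((s.arrivals : ℤ) :: s.buffer).take K, 0, s.received⟩) ∨
    (nextType a e s = true ∧ ∃ b, s.battery = b + 1 ∧ s.buffer = [] ∧ step K B a e s =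
      ⟨s.arrivals + 1, s.energy, [], b, ((s.arrivals : ℤ), a s.arrivals) :: s.received⟩) ∨
    (nextType a e s = false ∧ s.buffer = [] ∧ step K B a e s =
      ⟨s.arrivals, s.energy + 1, [], min (s.battery + 1) B, s.received⟩) ∨
    (nextType a e s = false ∧ ∃ p l, s.battery = 0 ∧ s.buffer = p :: l ∧ step K B a e s =
      ⟨s.arrivals, s.energy + 1, l, 0, (p, e s.energy) :: s.received⟩) := by
  cases h : nextType a e s with
  | true =>
    rw [step_of_nextType_true h]
    rcases hb : s.battery with _ | b
    · exact Or.inl ⟨rfl, rfl, statusArrival_of_battery_eq_zero _ _ hb⟩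
    · have hn : s.buffer = [] := hs.resolve_right (by omega)
      exact Or.inr (Or.inl ⟨rfl, b, rfl, hn, statusArrival_of_buffer_eq_nil hK _ hb hn⟩)
  | false =>
    rw [step_of_nextType_false h]
    rcases hb : s.buffer with _ | ⟨p, l⟩
    · exact Or.inr (Or.inr (Or.inl ⟨rfl, rfl, energyArrival_of_buffer_eq_nil _ _ hb⟩))
    · have hz : s.battery = 0 := hs.resolve_left (by simp [hb])
      exact Or.inr (Or.inr (Or.inr ⟨rfl, p, l, hz, rfl,
        energyArrival_of_buffer_eq_cons hB _ hz hb⟩))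

lemma initialState_buffer (S₀ : ℤ) :
    (initialState S₀).buffer = (List.range S₀.toNat).map fun i : ℕ => -((i : ℤ) + 1) := by
  simp only [initialState, List.bind_eq_flatMap, List.pure_def, ← List.map_eq_flatMap,
    List.map_map]
  rfl

lemma reachable_initialState {K B : ℕ} {S₀ : ℤ} (hS₀ : -(B : ℤ) ≤ S₀ ∧ S₀ ≤ (K : ℤ))
    (a e : ℕ → ℝ) : Reachable K B S₀ a e (initialState S₀) where
  empty := by
    rcases le_total S₀ 0 with h | h
    · left
      simp [initialState, Int.toNat_of_nonpos h]
    · right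
      simpa [initialState] using h
  length_le := by
    have := hS₀.2
    rw [initialState_buffer, List.length_map, List.length_range]
    omega
  battery_le := by
    have := hS₀.1
    simp only [initialState]
    omega
  sorted := by
    rw [initialState_buffer, List.pairwise_map]
    exact List.pairwise_lt_range.imp fun h => by omega
  buffer_lt := by
    simp only [initialState_buffer, List.mem_map, List.mem_range]
    rintro p ⟨i, _, rfl⟩
    have : (initialState S₀).arrivals = 0 := rfl
    omega
  buffer_ge := by
    simp only [initialState_buffer, List.mem_map, List.mem_range]
    rintro p ⟨i, _, rfl⟩
    omega
  received_lt := by simp [initialState]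
  received_ge := by simp [initialState]
  received_time := by simp [initialState]
  past_status := by simp [initialState]
  past_energy := by simp [initialState]

/-- The buffer stays sorted because an arriving packet is fresher than all stored ones, while
truncation and delivery remove packets at an end of the list. -/
lemma Reachable.step {K B : ℕ} (hK : 1 ≤ K) (hB : 1 ≤ B) {S₀ : ℤ} {a e : ℕ → ℝ}
    (ha : Monotone a) (he : Monotone e) {s : SystemState} (h : Reachable K B S₀ a e s) :
    Reachable K B S₀ a e (step K B a e s) := by
  have hps : nextType a e s = true → ∀ i < s.arrivals + 1, a i ≤ e s.energy := by
    intro ht i hi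
    rcases Nat.lt_succ_iff_lt_or_eq.1 hi with hi | rfl
    · exact h.past_status i hi
    · simp only [nextType, decide_eq_true_eq] at ht
      exact ht.le
  have hps' : ∀ j < s.energy, e j ≤ a (s.arrivals + 1) := fun j hj =>
    (h.past_energy j hj).trans (ha (Nat.le_succ _))
  have hpe : nextType a e s = false → ∀ i < s.energy + 1, e i ≤ a s.arrivals := by
    intro ht i hi
    rcases Nat.lt_succ_iff_lt_or_eq.1 hi with hi | rfl
    · exact h.past_energy i hi
    · simpa [nextType] using ht
  have hpe' : ∀ i < s.arrivals, a i ≤ e (s.energy + 1) := fun i hi =>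
    (h.past_status i hi).trans (he (Nat.le_succ _))
  have hlt : ∀ x ∈ s.received, x.1 < ((s.arrivals + 1 : ℕ) : ℤ) := fun x hx => by
    have := h.received_lt x hx
    push_cast
    omega
  rcases step_cases hK hB a e h.empty with ⟨ht, hb, hs⟩ | ⟨ht, b, hb, hn, hs⟩ | ⟨ht, hn, hs⟩ |
    ⟨ht, p, l, hb, hn, hs⟩ <;> rw [hs]
  · have hmem : ∀ p ∈ ((s.arrivals : ℤ) :: s.buffer).take K, p = s.arrivals ∨ p ∈ s.buffer :=
      fun p hp => List.mem_cons.1 (List.mem_of_mem_take hp)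
    refine ⟨Or.inr rfl, List.length_take_le _ _, Nat.zero_le _, ?_, ?_, ?_, hlt, h.received_ge,
      h.received_time, hps ht, hps'⟩
    · exact (List.pairwise_cons.2 ⟨h.buffer_lt, h.sorted⟩).sublist (List.take_sublist _ _)
    · intro p hp
      push_cast
      rcases hmem p hp with rfl | hp
      · omega
      · have := h.buffer_lt p hp
        omega
    · intro p hp
      rcases hmem p hp with rfl | hp
      · omega
      · exact h.buffer_ge p hp
  · refine ⟨Or.inl rfl, Nat.zero_le _, ?_, List.Pairwise.nil, by simp, by simp, ?_, ?_, ?_, hps ht,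
      hps'⟩
    · have := h.battery_le
      simp only
      omega
    · intro x hx
      rcases List.mem_cons.1 hx with rfl | hx
      · simp
      · exact hlt x hx
    · intro x hx
      rcases List.mem_cons.1 hx with rfl | hx
      · simp only
        omega
      · exact h.received_ge x hx
    · intro x hx n hxn
      rcases List.mem_cons.1 hx with rfl | hx
      · simp only [Nat.cast_inj] at hxn
        simp [hxn]
      · exact h.received_time x hx n hxn
  · exact ⟨Or.inl rfl, Nat.zero_le _, min_le_right _ _, List.Pairwise.nil, by simp, by simp,
      h.received_lt, h.received_ge, h.received_time, hpe', hpe ht⟩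
  · have hp : p ∈ s.buffer := by simp [hn]
    have hl : ∀ q ∈ l, q ∈ s.buffer := fun q hq => by simp [hn, hq]
    have hsorted := h.sorted
    have hlen := h.length_le
    rw [hn] at hsorted hlen
    refine ⟨Or.inr rfl, (Nat.le_succ _).trans hlen, Nat.zero_le _, hsorted.of_cons,
      fun q hq => h.buffer_lt q (hl q hq), fun q hq => h.buffer_ge q (hl q hq), ?_, ?_, ?_, hpe',
      hpe ht⟩
    · intro x hx
      rcases List.mem_cons.1 hx with rfl | hx
      · exact h.buffer_lt p hp
      · exact h.received_lt x hx
    · intro x hx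
      rcases List.mem_cons.1 hx with rfl | hx
      · exact h.buffer_ge p hp
      · exact h.received_ge x hx
    · intro x hx n hxn
      rcases List.mem_cons.1 hx with rfl | hx
      · have := h.buffer_lt p hp
        simp only at hxn
        exact h.past_status n (by omega)
      · exact h.received_time x hx n hxn

/-- One queue is always empty, so the walk alone tells whether an arriving packet finds energy. -/
lemma netLevel_neg_iff {K B : ℕ} {S₀ : ℤ} {a e : ℕ → ℝ} {s : SystemState}
    (h : Reachable K B S₀ a e s) : netLevel s < 0 ↔ 0 < s.battery := by
  rcases h.empty with h | h <;> simp [netLevel, h]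

/-- Evolution of the net level, a random walk kept between `-B` and `K`. -/
def levelStep (K B : ℕ) (x : ℤ) (c : Bool) : ℤ := if c then min (x + 1) K else max (x - 1) (-B)

lemma netLevel_step {K B : ℕ} (hK : 1 ≤ K) (hB : 1 ≤ B) {S₀ : ℤ} {a e : ℕ → ℝ} {s : SystemState}
    (h : Reachable K B S₀ a e s) :
    netLevel (step K B a e s) = levelStep K B (netLevel s) (nextType a e s) := by
  have hlen := h.length_le
  rcases step_cases hK hB a e h.empty with ⟨ht, hb, hs⟩ | ⟨ht, b, hb, hn, hs⟩ | ⟨ht, hn, hs⟩ |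
    ⟨ht, p, l, hb, hn, hs⟩ <;> rw [hs, ht]
  · simp only [netLevel, levelStep, hb, List.length_take, List.length_cons, if_true]
    omega
  · simp only [netLevel, levelStep, hb, hn, List.length_nil, if_true]
    omega
  · simp only [netLevel, levelStep, hn, List.length_nil, Bool.false_eq_true, if_false]
    omega
  · simp only [netLevel, levelStep, hb, hn, List.length_cons, Bool.false_eq_true, if_false]
    omega

lemma netLevel_initialState (S₀ : ℤ) : netLevel (initialState S₀) = S₀ := by
  rw [netLevel, initialState_buffer, List.length_map, List.length_range]
  simp only [initialState]
  omega

lemma arrivals_step {K B : ℕ} {a e : ℕ → ℝ} {s : SystemState} :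
    (step K B a e s).arrivals = s.arrivals + if nextType a e s then 1 else 0 := by
  cases h : nextType a e s with
  | true => rw [step_of_nextType_true h]; rfl
  | false => rw [step_of_nextType_false h]; rfl

lemma energy_step {K B : ℕ} {a e : ℕ → ℝ} {s : SystemState} :
    (step K B a e s).energy = s.energy + if nextType a e s then 0 else 1 := by
  cases h : nextType a e s with
  | true => rw [step_of_nextType_true h]; rfl
  | false => rw [step_of_nextType_false h]; rfl

/-! ### Packets overtaken by a fresher one -/

/-- Packet `n` can no longer become a valid update: if it is delivered at all, then after a fresher
one. -/
def Stale (n : ℕ) (s : SystemState) : Prop :=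
  ((n : ℤ) ∈ s.buffer → (n : ℤ) + 1 ∈ s.buffer ∨ ∃ x ∈ s.received, (n : ℤ) < x.1) ∧
    ∀ d before, ((n : ℤ), d) :: before <:+ s.received → ∃ x ∈ before, (n : ℤ) < x.1

/-- Truncation removes the tail, where the older packets are, so it cannot drop a fresher packet and
keep an older one. -/
lemma mem_take_of_pairwise_gt {l : List ℤ} (hl : l.Pairwise (· > ·)) {K : ℕ} {x y : ℤ}
    (hy : y ∈ l.take K) (hx : x ∈ l) (hxy : y < x) : x ∈ l.take K := by
  rw [← List.take_append_drop K l] at hx hl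
  rcases List.mem_append.1 hx with h | h
  · exact h
  · have := (List.pairwise_append.1 hl).2.2 y hy x h
    omega

/-- While `n` is stored, either `n + 1` stands ahead of it or a fresher packet has been received.
Truncation cannot lose `n + 1` before `n`; delivery of `n + 1` gives the second alternative; and
when `n` itself is at the front, `n + 1` is not stored, so the second alternative must hold. -/
lemma Stale.step {K B : ℕ} (hK : 1 ≤ K) (hB : 1 ≤ B) {S₀ : ℤ} {a e : ℕ → ℝ} {s : SystemState}
    (h : Reachable K B S₀ a e s) {n : ℕ} (hn : n < s.arrivals) (hst : Stale n s) :
    Stale n (step K B a e s) := by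
  rcases step_cases hK hB a e h.empty with ⟨ht, hb, hs⟩ | ⟨ht, b, hb, hnil, hs⟩ | ⟨ht, hnil, hs⟩ |
    ⟨ht, p, l, hb, hnil, hs⟩ <;> rw [hs]
  · refine ⟨fun hmem => ?_, hst.2⟩
    have hsorted : ((s.arrivals : ℤ) :: s.buffer).Pairwise (· > ·) :=
      List.pairwise_cons.2 ⟨h.buffer_lt, h.sorted⟩
    rcases List.mem_cons.1 (List.mem_of_mem_take hmem) with h1 | h1
    · omega
    · rcases hst.1 h1 with h2 | h2
      · exact Or.inl (mem_take_of_pairwise_gt hsorted hmem (List.mem_cons_of_mem _ h2) (by omega))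
      · exact Or.inr h2
  · refine ⟨fun hmem => by simp at hmem, fun d before hsuf => ?_⟩
    rcases List.suffix_cons_iff.1 hsuf with h1 | h1
    · simp only [List.cons.injEq, Prod.mk.injEq, Nat.cast_inj] at h1
      omega
    · exact hst.2 d before h1
  · exact ⟨fun hmem => by simp at hmem, hst.2⟩
  · have hst1 := hst.1
    have hsorted := h.sorted
    rw [hnil] at hst1 hsorted
    have hgt := (List.pairwise_cons.1 hsorted).1
    refine ⟨fun hmem => ?_, fun d before hsuf => ?_⟩
    · rcases hst1 (List.mem_cons_of_mem _ hmem) with h1 | ⟨x, hx, hlt⟩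
      · rcases List.mem_cons.1 h1 with h1 | h1
        · exact Or.inr ⟨(p, e s.energy), List.mem_cons_self, by simp only; omega⟩
        · exact Or.inl h1
      · exact Or.inr ⟨x, List.mem_cons_of_mem _ hx, hlt⟩
    · rcases List.suffix_cons_iff.1 hsuf with h1 | h1
      · simp only [List.cons.injEq, Prod.mk.injEq] at h1
        obtain ⟨⟨rfl, -⟩, rfl⟩ := h1
        rcases hst1 List.mem_cons_self with h2 | h2
        · rcases List.mem_cons.1 h2 with h2 | h2
          · omega
          · have := hgt _ h2
            omega
        · exact h2
      · exact hst.2 d before h1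

lemma received_suffix_step {K B : ℕ} (hK : 1 ≤ K) (hB : 1 ≤ B) {S₀ : ℤ} {a e : ℕ → ℝ}
    {s : SystemState} (h : Reachable K B S₀ a e s) :
    s.received <:+ (step K B a e s).received := by
  rcases step_cases hK hB a e h.empty with ⟨ht, hb, hs⟩ | ⟨ht, b, hb, hn, hs⟩ | ⟨ht, hn, hs⟩ |
    ⟨ht, p, l, hb, hn, hs⟩ <;> rw [hs]
  · exact List.suffix_cons _ _
  · exact List.suffix_cons _ _

/-! ### Sample paths: valid updates are the served packets -/

/-- Arrival times without ties, increasing to infinity, and a system started in an admissible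
state. -/
structure RegularPaths (K B : ℕ) (S₀ : ℤ) (a e : ℕ → ℝ) : Prop where
  one_le_K : 1 ≤ K
  one_le_B : 1 ≤ B
  start : -(B : ℤ) ≤ S₀ ∧ S₀ ≤ (K : ℤ)
  status_strictMono : StrictMono a
  energy_strictMono : StrictMono e
  status_tendsto : Tendsto a atTop atTop
  energy_tendsto : Tendsto e atTop atTop
  no_tie : ∀ k, a (run K B S₀ a e k).arrivals ≠ e (run K B S₀ a e k).energy

/-- Type of the event that follows the first `k` events. -/
noncomputable def eventType (K B : ℕ) (S₀ : ℤ) (a e : ℕ → ℝ) (k : ℕ) : Bool :=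
  nextType a e (run K B S₀ a e k)

/-- Status packet `n` finds a nonempty battery, or the event that follows its arrival is the arrival
of an energy packet. -/
def IsServed (K B : ℕ) (S₀ : ℤ) (a e : ℕ → ℝ) (n : ℕ) : Prop :=
  ∃ k, (run K B S₀ a e k).arrivals = n ∧ eventType K B S₀ a e k = true ∧
    (0 < (run K B S₀ a e k).battery ∨ eventType K B S₀ a e (k + 1) = false)

section Paths

variable {K B : ℕ} {S₀ : ℤ} {a e : ℕ → ℝ}

lemma arrivals_succ (k : ℕ) : (run K B S₀ a e (k + 1)).arrivals =
    (run K B S₀ a e k).arrivals + if eventType K B S₀ a e k then 1 else 0 :=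
  arrivals_step

lemma energy_succ (k : ℕ) : (run K B S₀ a e (k + 1)).energy =
    (run K B S₀ a e k).energy + if eventType K B S₀ a e k then 0 else 1 :=
  energy_step

lemma arrivals_mono : Monotone fun k => (run K B S₀ a e k).arrivals :=
  monotone_nat_of_le_succ fun k => by
    rw [arrivals_succ]
    exact Nat.le_add_right _ _

namespace RegularPaths

variable (h : RegularPaths K B S₀ a e)
include h

lemma reachable (k : ℕ) : Reachable K B S₀ a e (run K B S₀ a e k) := by
  induction k with
  | zero => exact reachable_initialState h.start a e
  | succ k ih =>
    exact ih.step h.one_le_K h.one_le_B h.status_strictMono.monotone h.energy_strictMono.monotone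

lemma netLevel_run (k : ℕ) :
    netLevel (run K B S₀ a e k) = drive (levelStep K B) S₀ (eventType K B S₀ a e) k := by
  induction k with
  | zero => exact netLevel_initialState S₀
  | succ k ih =>
    rw [drive, ← ih]
    exact netLevel_step h.one_le_K h.one_le_B (h.reachable k)

lemma received_suffix {j k : ℕ} (hjk : j ≤ k) :
    (run K B S₀ a e j).received <:+ (run K B S₀ a e k).received := by
  induction k, hjk using Nat.le_induction with
  | base => exact List.suffix_refl _
  | succ k _ ih =>
    exact ih.trans (received_suffix_step h.one_le_K h.one_le_B (h.reachable k))

/-- Otherwise all later events would be energy arrivals preceding one fixed status time, which is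
impossible as energy times tend to infinity. -/
lemma exists_next_status (k : ℕ) : ∃ j, (run K B S₀ a e j).arrivals = (run K B S₀ a e k).arrivals ∧
    eventType K B S₀ a e j = true := by
  by_contra! hcon
  have hall : ∀ d, (run K B S₀ a e (k + d)).arrivals = (run K B S₀ a e k).arrivals ∧
      (run K B S₀ a e (k + d)).energy = (run K B S₀ a e k).energy + d := by
    intro d
    induction d with
    | zero => simp
    | succ d ih =>
      have := hcon (k + d) ih.1
      rw [ne_eq, Bool.not_eq_true] at this
      rw [← add_assoc, arrivals_succ, energy_succ, this]
      simp [ih.1, ih.2, add_assoc]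
  obtain ⟨N, hN⟩ := (h.energy_tendsto.eventually_gt_atTop (a (run K B S₀ a e k).arrivals)).exists
  have h1 := hcon (k + N) (hall N).1
  have hlt : e N ≤ e (run K B S₀ a e (k + N)).energy :=
    h.energy_strictMono.monotone (by rw [(hall N).2]; omega)
  simp only [eventType, nextType, ne_eq, decide_eq_true_eq, (hall N).1] at h1
  exact h1 (hN.trans_le hlt)

lemma exists_arrival (n : ℕ) : ∃ k, (run K B S₀ a e k).arrivals = n ∧
    eventType K B S₀ a e k = true := by
  induction n with
  | zero => exact h.exists_next_status 0
  | succ n ih =>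
    obtain ⟨k, hk, ht⟩ := ih
    obtain ⟨j, hj, hj'⟩ := h.exists_next_status (k + 1)
    refine ⟨j, ?_, hj'⟩
    rw [hj, arrivals_succ, ht, hk]
    rfl

-- The arrival counter increases strictly at a status event, so each packet has a single arrival
-- event and the existential in `IsServed` concerns that event only.
omit h in
lemma arrival_unique {j k : ℕ} (hjk : (run K B S₀ a e j).arrivals = (run K B S₀ a e k).arrivals)
    (hj : eventType K B S₀ a e j = true) (hk : eventType K B S₀ a e k = true) : j = k := by
  have key : ∀ {j k : ℕ}, eventType K B S₀ a e j = true → j < k →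
      (run K B S₀ a e j).arrivals < (run K B S₀ a e k).arrivals := by
    intro j k hj hlt
    have h1 := arrivals_mono (K := K) (B := B) (S₀ := S₀) (a := a) (e := e) hlt
    simp only [Nat.succ_eq_add_one, arrivals_succ, hj, if_true] at h1
    omega
  rcases lt_trichotomy j k with hlt | heq | hlt
  · exact absurd hjk (key hj hlt).ne
  · exact heq
  · exact absurd hjk.symm (key hk hlt).ne

omit h in
lemma isServed_iff {k : ℕ} (hk : eventType K B S₀ a e k = true) :
    IsServed K B S₀ a e (run K B S₀ a e k).arrivals ↔
      (0 < (run K B S₀ a e k).battery ∨ eventType K B S₀ a e (k + 1) = false) := by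
  refine ⟨?_, fun hs => ⟨k, rfl, hk, hs⟩⟩
  rintro ⟨j, hj, hjt, hs⟩
  rwa [← arrival_unique hj hjt hk]

omit h in
lemma lt_of_eventType_true {k : ℕ} (hk : eventType K B S₀ a e k = true) :
    a (run K B S₀ a e k).arrivals < e (run K B S₀ a e k).energy := by
  simpa [eventType, nextType] using hk

lemma lt_of_eventType_false {k : ℕ} (hk : eventType K B S₀ a e k = false) :
    e (run K B S₀ a e k).energy < a (run K B S₀ a e k).arrivals := by
  have : e (run K B S₀ a e k).energy ≤ a (run K B S₀ a e k).arrivals := by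
    simpa [eventType, nextType] using hk
  exact lt_of_le_of_ne this (h.no_tie k).symm

omit h in
lemma run_succ_of_status {k : ℕ} (hk : eventType K B S₀ a e k = true) :
    run K B S₀ a e (k + 1) =
      statusArrival K (a (run K B S₀ a e k).arrivals) (run K B S₀ a e k) :=
  step_of_nextType_true hk

omit h in
lemma run_succ_of_energy {k : ℕ} (hk : eventType K B S₀ a e k = false) :
    run K B S₀ a e (k + 1) =
      energyArrival B (e (run K B S₀ a e k).energy) (run K B S₀ a e k) :=
  step_of_nextType_false hk

/-- The state just after a status packet has found an empty battery. -/
lemma run_succ_of_battery_eq_zero {k : ℕ} (hk : eventType K B S₀ a e k = true)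
    (hb : (run K B S₀ a e k).battery = 0) : ∃ l : List ℤ, run K B S₀ a e (k + 1) =
      ⟨(run K B S₀ a e k).arrivals + 1, (run K B S₀ a e k).energy,
        ((run K B S₀ a e k).arrivals : ℤ) :: l, 0, (run K B S₀ a e k).received⟩ := by
  refine ⟨(run K B S₀ a e k).buffer.take (K - 1), ?_⟩
  rw [run_succ_of_status hk, statusArrival_of_battery_eq_zero _ _ hb,
    List.take_cons h.one_le_K]

/-- Delivery occurs either on arrival or at an energy arrival before the next status packet, in both
cases when only older packets have been received. The bound by `a (n + 1)` is kept for counting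
deliveries before a given time. -/
lemma exists_validAt_of_isServed {n : ℕ} (hn : IsServed K B S₀ a e n) :
    ∃ d ≤ a (n + 1), IsValidUpdateAt K B S₀ a e n d := by
  obtain ⟨k, rfl, ht, hs⟩ := hn
  by_cases hb : (run K B S₀ a e k).battery = 0
  · have hE := hs.resolve_left (by omega)
    obtain ⟨l, hl⟩ := h.run_succ_of_battery_eq_zero ht hb
    have hlt := h.lt_of_eventType_false hE
    have hrun := run_succ_of_energy hE
    rw [energyArrival_of_buffer_eq_cons h.one_le_B _ (by rw [hl]) (by rw [hl])] at hrun
    rw [hl] at hlt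
    -- State `k + 2` follows both the arrival of the packet and the energy arrival that sends it.
    refine ⟨e (run K B S₀ a e k).energy, hlt.le, k + 2, (run K B S₀ a e k).received, ?_,
      (h.reachable k).received_lt⟩
    rw [hrun, hl]
  · obtain ⟨b, hb⟩ := Nat.exists_eq_succ_of_ne_zero hb
    have hnil := (h.reachable k).empty.resolve_right (by omega)
    have hrun := run_succ_of_status ht
    rw [statusArrival_of_buffer_eq_nil h.one_le_K _ hb hnil] at hrun
    refine ⟨a (run K B S₀ a e k).arrivals, h.status_strictMono.monotone (Nat.le_succ _), k + 1,
      (run K B S₀ a e k).received, ?_, (h.reachable k).received_lt⟩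
    rw [hrun]

/-- Two successive status arrivals at an empty battery leave `n + 1` in the buffer with `n` not yet
received. This is state `k + 2`, from which staleness persists. -/
lemma stale_of_not_isServed {k : ℕ} (ht : eventType K B S₀ a e k = true)
    (hs : ¬ IsServed K B S₀ a e (run K B S₀ a e k).arrivals) {j : ℕ} (hj : k + 2 ≤ j) :
    Stale (run K B S₀ a e k).arrivals (run K B S₀ a e j) := by
  rw [isServed_iff ht, not_or, not_lt, Nat.le_zero, Bool.not_eq_false] at hs
  induction j, hj using Nat.le_induction with
  | base =>
    obtain ⟨l, hl⟩ := h.run_succ_of_battery_eq_zero ht hs.1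
    obtain ⟨l', hl'⟩ := h.run_succ_of_battery_eq_zero hs.2 (by rw [hl])
    rw [hl] at hl'
    rw [show k + 2 = k + 1 + 1 from rfl, hl']
    refine ⟨fun _ => Or.inl (by simp), fun d before hsuf => ?_⟩
    have := (h.reachable k).received_lt _ (hsuf.subset List.mem_cons_self)
    simp at this
  | succ j hj ih =>
    have hlt : (run K B S₀ a e k).arrivals < (run K B S₀ a e j).arrivals := by
      have h1 := arrivals_mono (K := K) (B := B) (S₀ := S₀) (a := a) (e := e)
        (show k + 1 ≤ j by omega)
      simp only [arrivals_succ, ht, if_true] at h1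
      omega
    exact ih.step h.one_le_K h.one_le_B (h.reachable j) hlt

lemma isServed_of_validAt {n : ℕ} {d : ℝ} (hn : IsValidUpdateAt K B S₀ a e n d) :
    IsServed K B S₀ a e n := by
  by_contra hs
  obtain ⟨k, rfl, ht⟩ := h.exists_arrival n
  obtain ⟨j, before, hsuf, hbefore⟩ := hn
  -- An index late enough both for the reception to be recorded and for staleness to have begun; the
  -- reception history only grows at its front.
  have hst := h.stale_of_not_isServed ht hs (le_max_right j (k + 2))
  obtain ⟨x, hx, hlt⟩ := hst.2 d before (hsuf.trans (h.received_suffix (le_max_left j (k + 2))))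
  exact (hbefore x hx).not_gt hlt

lemma isValidUpdate_iff_isServed (n : ℕ) :
    IsValidUpdate K B S₀ a e n ↔ IsServed K B S₀ a e n := by
  refine ⟨fun ⟨d, hd⟩ => h.isServed_of_validAt hd, fun hn => ?_⟩
  obtain ⟨d, _, hd⟩ := h.exists_validAt_of_isServed hn
  exact ⟨d, hd⟩

lemma eventType_succ_eq_false_iff {k : ℕ} (hk : eventType K B S₀ a e k = true) :
    eventType K B S₀ a e (k + 1) = false ↔ ∃ m, a (run K B S₀ a e k).arrivals < e m ∧
      e m < a ((run K B S₀ a e k).arrivals + 1) := by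
  have h1 : (run K B S₀ a e (k + 1)).arrivals = (run K B S₀ a e k).arrivals + 1 := by
    rw [arrivals_succ, hk]; rfl
  have h2 : (run K B S₀ a e (k + 1)).energy = (run K B S₀ a e k).energy := by
    rw [energy_succ, hk]; rfl
  constructor
  · intro hE
    have := h.lt_of_eventType_false hE
    rw [h1, h2] at this
    exact ⟨_, lt_of_eventType_true hk, this⟩
  · rintro ⟨m, hm1, hm2⟩
    -- Energy arrivals already counted are no later than the arrival of the packet, so `m` is not
    -- among them.
    have hle : (run K B S₀ a e k).energy ≤ m := by
      by_contra! hlt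
      exact absurd ((h.reachable k).past_energy m hlt) (not_le.2 hm1)
    simp only [eventType, nextType, decide_eq_false_iff_not, not_lt, h1, h2]
    exact (h.energy_strictMono.monotone hle).trans hm2.le

lemma isValidUpdate_iff (n : ℕ) :
    IsValidUpdate K B S₀ a e n ↔ BatteryNonemptyOnArrival K B S₀ a e n ∨
      ∃ m, a n < e m ∧ e m < a (n + 1) := by
  rw [h.isValidUpdate_iff_isServed]
  obtain ⟨k, rfl, hk⟩ := h.exists_arrival n
  rw [isServed_iff hk, h.eventType_succ_eq_false_iff hk]
  refine or_congr ⟨fun hb => ⟨k, rfl, lt_of_eventType_true hk, hb⟩, ?_⟩ Iff.rfl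
  rintro ⟨j, hj, hlt, hb⟩
  have hjt : eventType K B S₀ a e j = true := by
    simpa [eventType, nextType, hj] using hlt
  rwa [← arrival_unique hj hjt hk]

end RegularPaths

open Classical in
/-- Number of served packets among the first `m` status packets. -/
noncomputable def servedCount (K B : ℕ) (S₀ : ℤ) (a e : ℕ → ℝ) (m : ℕ) : ℕ :=
  ((Finset.range m).filter fun n => IsServed K B S₀ a e n).card

namespace RegularPaths

variable (h : RegularPaths K B S₀ a e)
include h

lemma exists_of_validAt {p : ℤ} {d : ℝ} (hp : IsValidUpdateAt K B S₀ a e p d) :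
    -(S₀.toNat : ℤ) ≤ p ∧ ∀ n : ℕ, p = n → a n ≤ d ∧ IsServed K B S₀ a e n := by
  have hv := hp
  obtain ⟨k, before, hsuf, -⟩ := hp
  have hmem : (p, d) ∈ (run K B S₀ a e k).received := hsuf.subset List.mem_cons_self
  refine ⟨(h.reachable k).received_ge _ hmem, ?_⟩
  rintro n rfl
  exact ⟨(h.reachable k).received_time _ hmem n rfl, h.isServed_of_validAt hv⟩

-- A packet is received no earlier than it arrives, which bounds its index by `m`. The negative
-- names belong to packets stored at time `0` and are finitely many.
open Classical in
lemma valid_subset {T : ℝ} {m : ℕ} (hm : T ≤ a m) :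
    {p : ℤ | ∃ d < T, IsValidUpdateAt K B S₀ a e p d} ⊆
      (((Finset.range m).filter fun n => IsServed K B S₀ a e n).image ((↑) : ℕ → ℤ) ∪
        Finset.Ico (-(S₀.toNat : ℤ)) 0 : Finset ℤ) := by
  rintro p ⟨d, hd, hp⟩
  obtain ⟨hge, hn⟩ := h.exists_of_validAt hp
  simp only [Finset.coe_union, Finset.coe_image, Set.mem_union, Set.mem_image, Finset.mem_coe,
    Finset.mem_filter, Finset.mem_range, Finset.mem_Ico]
  rcases lt_or_ge p 0 with h0 | h0
  · exact Or.inr ⟨hge, h0⟩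
  · obtain ⟨n, rfl⟩ := Int.eq_ofNat_of_zero_le h0
    obtain ⟨h1, h2⟩ := hn n rfl
    exact Or.inl ⟨n, ⟨h.status_strictMono.lt_iff_lt.1 ((h1.trans_lt hd).trans_le hm), h2⟩, rfl⟩

lemma validUpdateCount_le {T : ℝ} {m : ℕ} (hm : T ≤ a m) :
    validUpdateCount K B S₀ a e T ≤ servedCount K B S₀ a e m + S₀.toNat := by
  classical
  refine (Set.ncard_le_ncard (h.valid_subset hm) (Finset.finite_toSet _)).trans ?_
  rw [Set.ncard_coe_finset]
  refine (Finset.card_union_le _ _).trans (add_le_add ?_ (by simp))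
  refine Finset.card_image_le.trans_eq ?_
  unfold servedCount
  congr

lemma le_validUpdateCount {T : ℝ} {m : ℕ} (hm : a m < T) :
    servedCount K B S₀ a e m ≤ validUpdateCount K B S₀ a e T := by
  classical
  -- `Set.ncard` is `0` on infinite sets, so the comparison needs finiteness of the larger set; an
  -- arrival time beyond `T` provides it.
  obtain ⟨M, hM⟩ := (h.status_tendsto.eventually_ge_atTop T).exists
  have hfin := (Finset.finite_toSet _).subset (h.valid_subset hM)
  have : servedCount K B S₀ a e m =
      (((Finset.range m).filter fun n => IsServed K B S₀ a e n).image ((↑) : ℕ → ℤ)).card := by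
    rw [Finset.card_image_of_injective _ Nat.cast_injective]
    unfold servedCount
    congr
  rw [this, ← Set.ncard_coe_finset]
  refine Set.ncard_le_ncard ?_ hfin
  rintro p hp
  simp only [Finset.coe_image, Set.mem_image, Finset.mem_coe, Finset.mem_filter,
    Finset.mem_range] at hp
  obtain ⟨n, ⟨hn, hs⟩, rfl⟩ := hp
  obtain ⟨d, hd, hv⟩ := h.exists_validAt_of_isServed hs
  exact ⟨d, (hd.trans (h.status_strictMono.monotone hn)).trans_lt hm, hv⟩

/-- The served packets, counted along the sequence of events. -/
lemma servedCount_arrivals (k : ℕ) :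
    servedCount K B S₀ a e (run K B S₀ a e k).arrivals = ∑ j ∈ Finset.range k,
      if eventType K B S₀ a e j = true ∧ (netLevel (run K B S₀ a e j) < 0 ∨
        eventType K B S₀ a e (j + 1) = false) then 1 else 0 := by
  classical
  induction k with
  | zero => simp [servedCount, run, initialState]
  | succ k ih =>
    rw [Finset.sum_range_succ, ← ih, arrivals_succ]
    cases hk : eventType K B S₀ a e k with
    | false => simp
    | true =>
      simp only [if_true, true_and, netLevel_neg_iff (h.reachable k), ← isServed_iff hk]
      unfold servedCount
      rw [Finset.range_add_one, Finset.filter_insert]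
      split_ifs with hs
      · rw [Finset.card_insert_of_notMem (by simp)]
      · rfl

end RegularPaths

lemma arrivals_eq_sum (k : ℕ) : (run K B S₀ a e k).arrivals =
    ∑ j ∈ Finset.range k, if eventType K B S₀ a e j then 1 else 0 := by
  induction k with
  | zero => rfl
  | succ k ih => rw [Finset.sum_range_succ, ← ih, arrivals_succ]

end Paths

/-! ### Long-run frequencies of levels and of served packets -/

/-- Average of the first `n` terms of a sequence. -/
noncomputable def avg (u : ℕ → ℝ) (n : ℕ) : ℝ := (∑ j ∈ Finset.range n, u j) / n

lemma avg_add (u v : ℕ → ℝ) (n : ℕ) : avg (fun j => u j + v j) n = avg u n + avg v n := by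
  simp [avg, Finset.sum_add_distrib, add_div]

lemma avg_sub (u v : ℕ → ℝ) (n : ℕ) : avg (fun j => u j - v j) n = avg u n - avg v n := by
  simp [avg, sub_div]

lemma avg_const_mul (r : ℝ) (u : ℕ → ℝ) (n : ℕ) : avg (fun j => r * u j) n = r * avg u n := by
  simp [avg, ← Finset.mul_sum, mul_div_assoc]

lemma avg_sum {ι : Type*} (s : Finset ι) (u : ι → ℕ → ℝ) (n : ℕ) :
    avg (fun j => ∑ i ∈ s, u i j) n = ∑ i ∈ s, avg (u i) n := by
  simp only [avg]
  rw [Finset.sum_comm, Finset.sum_div]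

lemma tendsto_avg_one : Tendsto (avg fun _ => 1) atTop (𝓝 1) := by
  refine tendsto_const_nhds.congr' ?_
  filter_upwards [eventually_ge_atTop 1] with n hn
  have : (n : ℝ) ≠ 0 := by exact_mod_cast (by omega : n ≠ 0)
  simp [avg, this]

lemma tendsto_avg_shift {u : ℕ → ℝ} {l : ℝ} (hu : Tendsto (avg u) atTop (𝓝 l)) (h0 : u 0 = 0) :
    Tendsto (avg fun j => u (j + 1)) atTop (𝓝 l) := by
  have h1 : Tendsto (fun n : ℕ => avg u (n + 1) * (((n : ℝ) + 1) / n)) atTop (𝓝 (l * 1)) := by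
    refine (hu.comp (tendsto_add_atTop_nat 1)).mul ?_
    have : Tendsto (fun n : ℕ => 1 + 1 / (n : ℝ)) atTop (𝓝 (1 + 0)) :=
      tendsto_const_nhds.add (tendsto_const_div_atTop_nhds_zero_nat 1)
    rw [add_zero] at this
    refine this.congr' ?_
    filter_upwards [eventually_ge_atTop 1] with n hn
    have : (n : ℝ) ≠ 0 := by exact_mod_cast (by omega : n ≠ 0)
    field_simp
  rw [mul_one] at h1
  refine h1.congr fun n => ?_
  have : (n : ℝ) + 1 ≠ 0 := by positivity
  rw [avg, avg, Finset.sum_range_succ', h0, add_zero]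
  push_cast
  field_simp

lemma tendsto_avg_zero_of_bounded {u : ℕ → ℝ} {C : ℝ}
    (hu : ∀ n, |∑ j ∈ Finset.range n, u j| ≤ C) : Tendsto (avg u) atTop (𝓝 0) := by
  refine squeeze_zero_norm (fun n => ?_) (tendsto_const_div_atTop_nhds_zero_nat C)
  rw [avg, Real.norm_eq_abs, abs_div, Nat.abs_cast]
  gcongr
  exact hu n

/-- Indicator of the letter `true`. -/
noncomputable def bit (c : Bool) : ℝ := if c then 1 else 0

/-- Indicator of the level `x`. -/
noncomputable def atLevel (x y : ℤ) : ℝ := if y = x then 1 else 0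

/-- Indicator of the negative levels. -/
noncomputable def negLevel (y : ℤ) : ℝ := if y < 0 then 1 else 0

/-- Net level together with a flag, raised when the last event was the arrival of a status packet
that found the battery empty. -/
def flagStep (K B : ℕ) (q : ℤ × Bool) (c : Bool) : ℤ × Bool :=
  (levelStep K B q.1 c, c && decide (0 ≤ q.1))

lemma drive_flagStep_fst (K B : ℕ) (q : ℤ × Bool) (c : ℕ → Bool) (k : ℕ) :
    (drive (flagStep K B) q c k).1 = drive (levelStep K B) q.1 c k := by
  induction k with
  | zero => rfl
  | succ k ih => rw [drive, drive, ← ih]; rfl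

/-- The averages along a sequence of event types that the law of large numbers controls. -/
structure TypicalTypes (K B : ℕ) (S₀ : ℤ) (p : ℝ) (c : ℕ → Bool) : Prop where
  types : Tendsto (avg fun j => centred p (c j)) atTop (𝓝 0)
  level : ∀ x, Tendsto (avg fun j => atLevel x (drive (levelStep K B) S₀ c j) * centred p (c j))
    atTop (𝓝 0)
  negative : Tendsto (avg fun j => negLevel (drive (levelStep K B) S₀ c j) * centred p (c j))
    atTop (𝓝 0)
  flag : Tendsto (avg fun j => bit (drive (flagStep K B) (S₀, false) c j).2 * centred p (c j))
    atTop (𝓝 0)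

section Level

variable {K B : ℕ} {S₀ : ℤ} {c : ℕ → Bool}

lemma drive_levelStep_mem (hS₀ : -(B : ℤ) ≤ S₀ ∧ S₀ ≤ (K : ℤ)) (k : ℕ) :
    -(B : ℤ) ≤ drive (levelStep K B) S₀ c k ∧ drive (levelStep K B) S₀ c k ≤ (K : ℤ) := by
  induction k with
  | zero => exact hS₀
  | succ k ih =>
    rw [drive, levelStep]
    split_ifs <;> omega

/-- Up-crossings and down-crossings between neighbouring levels alternate. -/
lemma sum_crossings {x : ℤ} (hx : -(B : ℤ) ≤ x) (hx' : x < K) (n : ℕ) :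
    ∑ j ∈ Finset.range n, (atLevel x (drive (levelStep K B) S₀ c j) * bit (c j) -
      atLevel (x + 1) (drive (levelStep K B) S₀ c j) * (1 - bit (c j))) =
    (if x < drive (levelStep K B) S₀ c n then 1 else 0) - (if x < S₀ then 1 else 0) := by
  induction n with
  | zero => exact (sub_self _).symm
  | succ n ih =>
    rw [Finset.sum_range_succ, ih, drive]
    generalize (if x < S₀ then (1 : ℝ) else 0) = w
    generalize drive (levelStep K B) S₀ c n = y
    -- As `-B ≤ x < K`, blocking at the ends never affects the edge from `x` to `x + 1`: the side of
    -- the edge changes only by an up-step from `x` or a down-step from `x + 1`.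
    have hlt : x < levelStep K B y (c n) ↔ (x < y ∧ ¬(y = x + 1 ∧ c n = false)) ∨
        (y = x ∧ c n = true) := by
      cases c n <;> simp [levelStep] <;> omega
    simp only [hlt]
    cases hc : c n with
    | true =>
      rcases lt_trichotomy y x with h | h | h
      · simp [atLevel, bit, h.ne, h.not_gt]
      · simp [atLevel, bit, h]
        ring
      · simp [atLevel, bit, h.ne', h]
    | false =>
      by_cases h : y = x + 1
      · simp [atLevel, bit, h]
        ring
      · simp [atLevel, bit, h]

lemma tendsto_crossings {x : ℤ} (hx : -(B : ℤ) ≤ x) (hx' : x < K) :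
    Tendsto (avg fun j => atLevel x (drive (levelStep K B) S₀ c j) * bit (c j) -
      atLevel (x + 1) (drive (levelStep K B) S₀ c j) * (1 - bit (c j))) atTop (𝓝 0) := by
  refine tendsto_avg_zero_of_bounded (C := 1) fun n => ?_
  rw [sum_crossings hx hx']
  split_ifs <;> norm_num

namespace TypicalTypes

variable {p : ℝ} (h : TypicalTypes K B S₀ p c)
include h

/-- Detailed balance of the frequencies of neighbouring levels. -/
lemma tendsto_balance {x : ℤ} (hx : -(B : ℤ) ≤ x) (hx' : x < K) :
    Tendsto (fun n => p * avg (fun j => atLevel x (drive (levelStep K B) S₀ c j)) n -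
      (1 - p) * avg (fun j => atLevel (x + 1) (drive (levelStep K B) S₀ c j)) n) atTop (𝓝 0) := by
  have := ((tendsto_crossings (S₀ := S₀) (c := c) hx hx').sub (h.level x)).sub (h.level (x + 1))
  simp only [sub_zero] at this
  refine this.congr fun n => ?_
  rw [← avg_const_mul, ← avg_const_mul, ← avg_sub, ← avg_sub, ← avg_sub]
  congr 1
  funext j
  simp only [centred, bit]
  ring

/-- Balance is iterated upwards from the bottom level, one factor `θ` per level. The statement
concerns a difference because convergence of the individual frequencies is not yet known. -/
lemma tendsto_level_sub {θ : ℝ} (hp : p < 1) (hθ : θ = p / (1 - p)) {i : ℕ} (hi : i ≤ B + K) :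
    Tendsto (fun n => avg (fun j => atLevel (-B + i) (drive (levelStep K B) S₀ c j)) n -
      θ ^ i * avg (fun j => atLevel (-B) (drive (levelStep K B) S₀ c j)) n) atTop (𝓝 0) := by
  have hq : 1 - p ≠ 0 := by linarith
  induction i with
  | zero => simp
  | succ i ih =>
    have h1 := ((ih (by omega)).const_mul θ).sub
      ((h.tendsto_balance (x := -B + i) (by omega) (by omega)).const_mul (1 / (1 - p)))
    simp only [mul_zero, sub_zero] at h1
    refine h1.congr fun n => ?_
    push_cast
    rw [← add_assoc]
    have key : ∀ u w : ℝ, 1 / (1 - p) * (p * u - (1 - p) * w) = θ * u - w := fun u w => by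
      rw [hθ]
      field_simp
    rw [key]
    ring

/-- The frequencies of all `B + K + 1` levels sum to one, and each is asymptotically a fixed
multiple of the bottom one; this forces convergence. -/
lemma tendsto_bottom {θ : ℝ} (hp : p < 1) (hθ : θ = p / (1 - p)) (hθ0 : 0 < θ)
    (hS₀ : -(B : ℤ) ≤ S₀ ∧ S₀ ≤ (K : ℤ)) :
    Tendsto (avg fun j => atLevel (-B) (drive (levelStep K B) S₀ c j)) atTop
      (𝓝 (1 / ∑ i ∈ Finset.range (B + K + 1), θ ^ i)) := by
  set G := ∑ i ∈ Finset.range (B + K + 1), θ ^ i with hG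
  have hGpos : 0 < G := Finset.sum_pos (fun i _ => by positivity) (by simp)
  have h1 := tendsto_finsetSum (Finset.range (B + K + 1)) fun i hi =>
    h.tendsto_level_sub hp hθ (i := i) (by simpa [Nat.lt_succ_iff] using hi)
  have h2 := ((tendsto_avg_one).sub h1).div_const G
  simp only [Finset.sum_const_zero, sub_zero] at h2
  refine h2.congr fun n => ?_
  have hone : avg (fun _ => 1) n = ∑ i ∈ Finset.range (B + K + 1),
      avg (fun j => atLevel (-B + i) (drive (levelStep K B) S₀ c j)) n := by
    rw [← avg_sum]
    congr 1
    funext j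
    obtain ⟨h3, h4⟩ := drive_levelStep_mem (c := c) hS₀ j
    rw [Finset.sum_eq_single (drive (levelStep K B) S₀ c j + B).toNat]
    · simp only [atLevel]
      rw [if_pos (by omega)]
    · intro i _ hi
      simp only [atLevel]
      rw [if_neg (by omega)]
    · intro hi
      simp only [Finset.mem_range, not_lt] at hi
      omega
  rw [hone, Finset.sum_sub_distrib, ← Finset.sum_mul, ← hG]
  field_simp
  ring

lemma tendsto_negLevel {θ : ℝ} (hp : p < 1) (hθ : θ = p / (1 - p)) (hθ0 : 0 < θ)
    (hS₀ : -(B : ℤ) ≤ S₀ ∧ S₀ ≤ (K : ℤ)) :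
    Tendsto (avg fun j => negLevel (drive (levelStep K B) S₀ c j)) atTop
      (𝓝 ((∑ i ∈ Finset.range B, θ ^ i) / ∑ i ∈ Finset.range (B + K + 1), θ ^ i)) := by
  have h0 := h.tendsto_bottom hp hθ hθ0 hS₀
  have h1 := tendsto_finsetSum (Finset.range B) fun i hi =>
    (h.tendsto_level_sub hp hθ (i := i) (by have := Finset.mem_range.1 hi; omega)).add
      (h0.const_mul (θ ^ i))
  simp only [sub_add_cancel, zero_add, ← Finset.sum_mul] at h1
  rw [mul_one_div] at h1
  refine h1.congr fun n => ?_
  rw [← avg_sum]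
  congr 1
  funext j
  obtain ⟨h3, h4⟩ := drive_levelStep_mem (c := c) hS₀ j
  by_cases hneg : drive (levelStep K B) S₀ c j < 0
  · rw [Finset.sum_eq_single (drive (levelStep K B) S₀ c j + B).toNat]
    · simp only [atLevel, negLevel, if_pos hneg]
      rw [if_pos (by omega)]
    · intro i _ hi
      simp only [atLevel]
      rw [if_neg (by omega)]
    · intro hi
      simp only [Finset.mem_range, not_lt] at hi
      omega
  · simp only [negLevel, if_neg hneg]
    refine Finset.sum_eq_zero fun i hi => ?_
    have := Finset.mem_range.1 hi
    simp only [atLevel]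
    rw [if_neg (by omega)]

lemma tendsto_bit : Tendsto (avg fun j => bit (c j)) atTop (𝓝 p) := by
  have := h.types.add (tendsto_avg_one.const_mul p)
  simp only [zero_add, mul_one] at this
  refine this.congr fun n => ?_
  rw [← avg_const_mul, ← avg_add]
  congr 1
  funext j
  simp [centred, bit]

/-- Frequency of the arrivals of status packets that get served. -/
lemma tendsto_served {π : ℝ}
    (hπ : Tendsto (avg fun j => negLevel (drive (levelStep K B) S₀ c j)) atTop (𝓝 π)) :
    Tendsto (avg fun j => if c j = true ∧ (drive (levelStep K B) S₀ c j < 0 ∨ c (j + 1) = false)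
      then 1 else 0) atTop (𝓝 (p * (π + (1 - π) * (1 - p)))) := by
  have hneg : Tendsto (avg fun j => negLevel (drive (levelStep K B) S₀ c j) * bit (c j)) atTop
      (𝓝 (p * π)) := by
    have := h.negative.add (hπ.const_mul p)
    simp only [zero_add] at this
    refine this.congr fun n => ?_
    rw [← avg_const_mul, ← avg_add]
    congr 1
    funext j
    simp only [centred, bit]
    ring
  -- Being served may depend on the following letter, which is the one read in the flagged state `j
  -- + 1`. The shift of index is harmless because the flag starts lowered.
  have hflag := tendsto_avg_shift h.flag (by simp [drive, bit])
  have := (hneg.add ((h.tendsto_bit.sub hneg).mul_const (1 - p))).sub hflag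
  -- The indicator of a served arrival equals `neg * bit + (1 - p) * (bit - neg * bit)` minus the
  -- flag at `j + 1` times the centred letter `j + 1`: the unknown next letter is replaced by its
  -- mean plus a negligible fluctuation.
  rw [show p * (π + (1 - π) * (1 - p)) = p * π + (p - p * π) * (1 - p) - 0 by ring]
  refine this.congr fun n => ?_
  rw [mul_comm _ (1 - p), ← avg_sub, ← avg_const_mul, ← avg_add, ← avg_sub]
  congr 1
  funext j
  have h2 : (drive (flagStep K B) (S₀, false) c (j + 1)).2 =
      (c j && decide (0 ≤ drive (levelStep K B) S₀ c j)) := by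
    rw [drive, flagStep, drive_flagStep_fst]
  rw [h2]
  by_cases hx : drive (levelStep K B) S₀ c j < 0
  · cases hc : c j <;> simp [hx, not_le.2 hx, negLevel, bit, centred]
  · cases hc : c j <;> cases hc' : c (j + 1) <;>
      simp [hx, not_lt.1 hx, negLevel, bit, centred]

end TypicalTypes

end Level

/-- The frequency of served packets in terms of `θ`. -/
lemma served_frequency_eq {θ : ℝ} (hθ0 : 0 < θ) (hθ1 : θ ≠ 1) (K B : ℕ) :
    (∑ i ∈ Finset.range B, θ ^ i) / (∑ i ∈ Finset.range (B + K + 1), θ ^ i) +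
      (1 - (∑ i ∈ Finset.range B, θ ^ i) / ∑ i ∈ Finset.range (B + K + 1), θ ^ i) *
        (1 - θ / (1 + θ)) =
    ((θ ^ (-(B : ℤ)) - 1) * (1 + θ) + (1 - θ ^ (K + 1))) /
      ((θ ^ (-(B : ℤ)) - θ ^ (K + 1)) * (1 + θ)) := by
  have h1 : θ - 1 ≠ 0 := sub_ne_zero.2 hθ1
  have hG : θ ^ B * θ ^ (K + 1) - 1 ≠ 0 := by
    rw [← pow_add, sub_ne_zero]
    exact fun hcon => hθ1 ((pow_eq_one_iff_of_nonneg hθ0.le (by omega)).1 hcon)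
  have hG' : 1 - θ ^ B * θ ^ (K + 1) ≠ 0 := by
    rw [← neg_sub]
    exact neg_ne_zero.2 hG
  have hB : θ ^ B ≠ 0 := by positivity
  -- The geometric formula requires `θ ≠ 1`; its common denominator `θ - 1` cancels in the quotient.
  rw [geom_sum_eq hθ1, geom_sum_eq hθ1, div_div_div_cancel_right₀ h1, add_assoc B K 1,
    pow_add θ B, zpow_neg, zpow_natCast]
  generalize θ ^ (K + 1) = y at *
  generalize θ ^ B = x at *
  have h2 : x⁻¹ - y ≠ 0 := by
    rw [show x⁻¹ - y = (1 - x * y) / x by field_simp]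
    exact div_ne_zero hG' hB
  have h3 : 1 + θ ≠ 0 := by positivity
  have h4 : x⁻¹ - y = (1 - x * y) / x := by field_simp
  rw [h4]
  field_simp
  ring

/-! ### Growth of the arrival times and law of the gaps -/

/-- Multiplying the exponential density by `x` gives `1 / r` times the Gamma density of shape `2`,
whose total mass is one. -/
lemma lintegral_ofReal_expMeasure {r : ℝ} (hr : 0 < r) :
    ∫⁻ x, ENNReal.ofReal x ∂(expMeasure r) = ENNReal.ofReal (1 / r) := by
  have hpt : ∀ x, exponentialPDF r x * ENNReal.ofReal x =
      ENNReal.ofReal (1 / r) * gammaPDF 2 r x := by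
    intro x
    rcases lt_or_ge x 0 with hx | hx
    · rw [exponentialPDF_of_neg hx, gammaPDF_of_neg hx]
      simp
    · rw [exponentialPDF_of_nonneg hx, gammaPDF_of_nonneg hx, ← ENNReal.ofReal_mul (by positivity),
        ← ENNReal.ofReal_mul (by positivity)]
      congr 1
      rw [show (2 : ℝ) - 1 = 1 by norm_num, Real.rpow_one, Real.rpow_two, Real.Gamma_two]
      field_simp
  rw [lintegral_expMeasure _ _ ENNReal.measurable_ofReal]
  simp_rw [hpt]
  rw [lintegral_const_mul' _ _ ENNReal.ofReal_ne_top, lintegral_gammaPDF_eq_one two_pos hr, mul_one]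

lemma integrable_id_expMeasure {r : ℝ} (hr : 0 < r) : Integrable id (expMeasure r) := by
  refine (lintegral_ofReal_ne_top_iff_integrable measurable_id.aestronglyMeasurable
    (ae_nonneg_expMeasure r)).1 ?_
  simp only [id]
  rw [lintegral_ofReal_expMeasure hr]
  exact ENNReal.ofReal_ne_top

lemma integral_id_expMeasure {r : ℝ} (hr : 0 < r) : ∫ x, x ∂(expMeasure r) = 1 / r := by
  rw [integral_eq_lintegral_of_nonneg_ae (ae_nonneg_expMeasure r)
    measurable_id.aestronglyMeasurable]
  simp only [lintegral_ofReal_expMeasure hr]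
  exact ENNReal.toReal_ofReal (by positivity)

lemma sum_gap {Ω : Type*} (A : ℕ → Ω → ℝ) (n : ℕ) (ω : Ω) :
    ∑ i ∈ Finset.range (n + 1), gap A i ω = A n ω := by
  induction n with
  | zero => simp [gap]
  | succ n ih =>
    rw [Finset.sum_range_succ, ih]
    simp [gap]

lemma strictMono_of_gap_pos {Ω : Type*} {A : ℕ → Ω → ℝ} {ω : Ω} (h : ∀ n, 0 < gap A n ω) :
    StrictMono fun n => A n ω :=
  strictMono_nat_of_lt_succ fun n => sub_pos.1 (h (n + 1))

lemma tendsto_atTop_of_tendsto_div {a : ℕ → ℝ} {l : ℝ} (hl : 0 < l)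
    (h : Tendsto (fun n : ℕ => a n / ((n : ℝ) + 1)) atTop (𝓝 l)) : Tendsto a atTop atTop := by
  have h1 : Tendsto (fun n : ℕ => (n : ℝ) + 1) atTop atTop :=
    tendsto_atTop_add_const_right _ _ tendsto_natCast_atTop_atTop
  refine (h.pos_mul_atTop hl h1).congr fun n => ?_
  have : (n : ℝ) + 1 ≠ 0 := by positivity
  field_simp

/-- Gaps of a sequence of arrival times. -/
def increments (a : ℕ → ℝ) : ℕ → ℝ
  | 0 => a 0
  | n + 1 => a (n + 1) - a n

lemma measurable_increments : Measurable increments := by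
  refine measurable_pi_lambda _ fun n => ?_
  cases n with
  | zero => exact measurable_pi_apply 0
  | succ n => exact (measurable_pi_apply (n + 1)).sub (measurable_pi_apply n)

lemma increments_eq_gap {Ω : Type*} (A : ℕ → Ω → ℝ) (ω : Ω) :
    increments (fun n => A n ω) = fun n => gap A n ω := by
  funext n
  cases n <;> rfl

section Poisson

variable {Ω : Type*} [MeasurableSpace Ω] {μ : Measure Ω} {rate : ℝ} {A : ℕ → Ω → ℝ}

lemma IsPoissonArrivals.measurable_gap (hA : IsPoissonArrivals μ rate A) (n : ℕ) :
    Measurable (gap A n) := by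
  cases n with
  | zero => exact hA.measurable 0
  | succ n => exact (hA.measurable (n + 1)).sub (hA.measurable n)

/-- The `n`-th arrival time grows like `n / rate`. -/
lemma IsPoissonArrivals.ae_tendsto_div (hrate : 0 < rate) (hA : IsPoissonArrivals μ rate A) :
    ∀ᵐ ω ∂μ, Tendsto (fun n : ℕ => A n ω / ((n : ℝ) + 1)) atTop (𝓝 (1 / rate)) := by
  have hm := hA.measurable_gap
  have hint : Integrable (gap A 0) μ := by
    have := integrable_id_expMeasure hrate
    rw [← hA.gap_law 0, integrable_map_measure measurable_id.aestronglyMeasurable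
      (hm 0).aemeasurable] at this
    exact this
  have hmean : ∫ ω, gap A 0 ω ∂μ = 1 / rate := by
    rw [← integral_id_expMeasure hrate, ← hA.gap_law 0,
      integral_map (hm 0).aemeasurable (f := fun x : ℝ => x) measurable_id.aestronglyMeasurable]
  have := strong_law_ae_real (gap A) hint (fun i j hij => hA.gap_indep.indepFun hij)
    (fun i => ⟨(hm i).aemeasurable, (hm 0).aemeasurable, by rw [hA.gap_law, hA.gap_law]⟩)
  filter_upwards [this] with ω hω
  rw [hmean] at hω
  refine (hω.comp (tendsto_add_atTop_nat 1)).congr fun n => ?_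
  simp only [Function.comp, sum_gap]
  push_cast
  rfl

lemma IsPoissonArrivals.ae_gap_pos (hA : IsPoissonArrivals μ rate A) :
    ∀ᵐ ω ∂μ, ∀ n, 0 < gap A n ω := by
  refine ae_all_iff.2 fun n => ?_
  have := ae_pos_expMeasure rate
  rw [← hA.gap_law n] at this
  exact ae_of_ae_map (hA.measurable_gap n).aemeasurable this

lemma IsPoissonArrivals.map_increments [IsProbabilityMeasure μ]
    (hA : IsPoissonArrivals μ rate A) :
    μ.map (fun ω => increments fun n => A n ω) = gapLaw rate := by
  simp_rw [increments_eq_gap]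
  rw [hA.gap_indep.map_fun_eq_infinitePi_map hA.measurable_gap]
  simp_rw [hA.gap_law]
  rfl

lemma map_increments_prod [IsProbabilityMeasure μ] {l r : ℝ} {E : ℕ → Ω → ℝ}
    (hA : IsPoissonArrivals μ l A) (hE : IsPoissonArrivals μ r E)
    (hAE : IndepFun (fun ω n => A n ω) (fun ω n => E n ω) μ) :
    μ.map (fun ω => (increments fun n => A n ω, increments fun n => E n ω)) = gapsLaw l r := by
  have h1 : Measurable fun ω => increments fun n => A n ω :=
    measurable_increments.comp (measurable_pi_lambda _ hA.measurable)
  have h2 : Measurable fun ω => increments fun n => E n ω :=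
    measurable_increments.comp (measurable_pi_lambda _ hE.measurable)
  have := (indepFun_iff_map_prod_eq_prod_map_map h1.aemeasurable h2.aemeasurable).1
    (hAE.comp measurable_increments measurable_increments)
  rw [this, hA.map_increments, hE.map_increments]
  rfl

end Poisson

/-! ### Event types of the system as independent letters -/

/-- The residual gaps after `k` events, in terms of the state of the system. -/
lemma residual_iterate (K B : ℕ) (S₀ : ℤ) (a e : ℕ → ℝ) (k : ℕ) :
    (residual^[k] (increments a, increments e)).1 0 -
        (residual^[k] (increments a, increments e)).2 0 =
      a (run K B S₀ a e k).arrivals - e (run K B S₀ a e k).energy ∧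
    (∀ i, (residual^[k] (increments a, increments e)).1 (i + 1) =
      a ((run K B S₀ a e k).arrivals + i + 1) - a ((run K B S₀ a e k).arrivals + i)) ∧
    ∀ i, (residual^[k] (increments a, increments e)).2 (i + 1) =
      e ((run K B S₀ a e k).energy + i + 1) - e ((run K B S₀ a e k).energy + i) := by
  -- Only the difference of the two leading gaps is tracked, since its sign decides the next type;
  -- their separate values would involve the current time.
  induction k with
  | zero =>
    refine ⟨rfl, fun i => ?_, fun i => ?_⟩ <;>
      simp [increments, run, initialState]
  | succ k ih =>
    obtain ⟨h0, h1, h2⟩ := ih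
    rw [Function.iterate_succ_apply', arrivals_succ, energy_succ]
    generalize residual^[k] (increments a, increments e) = w at *
    have hiff : w.1 0 < w.2 0 ↔ eventType K B S₀ a e k = true := by
      rw [eventType, nextType, decide_eq_true_eq, ← sub_neg, h0, sub_neg]
    by_cases hw : w.1 0 < w.2 0
    · simp only [residual, if_pos hw, if_pos (hiff.1 hw)]
      refine ⟨?_, fun i => ?_, fun i => ?_⟩
      · have := h1 0
        simp only [zero_add, add_zero] at this ⊢
        rw [this]
        simp only [consSeq]
        linarith
      · rw [h1]
        congr 2 <;> ring
      · simpa [consSeq] using h2 i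
    · simp only [residual, if_neg hw, if_neg (fun hcon => hw (hiff.2 hcon))]
      refine ⟨?_, fun i => ?_, fun i => ?_⟩
      · have := h2 0
        simp only [zero_add, add_zero] at this ⊢
        rw [this]
        simp only [consSeq]
        linarith
      · simpa [consSeq] using h1 i
      · rw [h2]
        congr 2 <;> ring

/-- Bridge between the queueing system and the shift on gaps: almost sure statements for the gap law
become statements about the events of the system. -/
lemma firstType_residual_iterate (K B : ℕ) (S₀ : ℤ) (a e : ℕ → ℝ) (k : ℕ) :
    firstType (residual^[k] (increments a, increments e)) = eventType K B S₀ a e k := by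
  have := (residual_iterate K B S₀ a e k).1
  rw [firstType, eventType, nextType, decide_eq_decide, ← sub_neg, this, sub_neg]

lemma measurePreserving_residual {l r : ℝ} (hl : 0 < l) (hr : 0 < r) :
    MeasurePreserving residual (gapsLaw l r) (gapsLaw l r) := by
  have := isProbabilityMeasure_typeLaw hl hr
  have := isProbabilityMeasure_gapsLaw hl hr
  refine ⟨measurable_residual, ?_⟩
  have h := congrArg (Measure.map Prod.snd) (map_firstType_residual hl hr)
  rw [Measure.map_map measurable_snd (measurable_firstType.prodMk measurable_residual),
    Measure.map_snd_prod, measure_univ, one_smul] at h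
  exact h

lemma ae_first_ne {l r : ℝ} (hl : 0 < l) (hr : 0 < r) :
    ∀ᵐ z ∂(gapsLaw l r), z.1 0 ≠ z.2 0 := by
  have := isProbabilityMeasure_gapLaw hl
  have := isProbabilityMeasure_gapLaw hr
  have := isProbabilityMeasure_expMeasure hr
  have hm : MeasurableSet {z : (ℕ → ℝ) × (ℕ → ℝ) | z.1 0 = z.2 0} :=
    measurableSet_eq_fun ((measurable_pi_apply 0).comp measurable_fst)
      ((measurable_pi_apply 0).comp measurable_snd)
  rw [ae_iff]
  simp only [ne_eq, not_not, gapsLaw]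
  rw [Measure.measure_prod_null hm]
  refine ae_of_all _ fun x => ?_
  have : Prod.mk x ⁻¹' {z : (ℕ → ℝ) × (ℕ → ℝ) | z.1 0 = z.2 0} =
      (fun y : ℕ → ℝ => y 0) ⁻¹' {x 0} := by
    ext y
    simp [eq_comm]
  beta_reduce
  rw [this, ← Measure.map_apply (measurable_pi_apply 0) (measurableSet_singleton _), gapLaw,
    Measure.infinitePi_map_eval]
  exact measure_singleton _

/-- `residual` preserves the law of the gaps, so the absence of a tie at the first event carries
over to every event. -/
lemma ae_no_tie {l r : ℝ} (hl : 0 < l) (hr : 0 < r) :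
    ∀ᵐ z ∂(gapsLaw l r), ∀ k, (residual^[k] z).1 0 ≠ (residual^[k] z).2 0 :=
  ae_all_iff.2 fun k =>
    ((measurePreserving_residual hl hr).iterate k).quasiMeasurePreserving.ae (ae_first_ne hl hr)

lemma typeLaw_real_true {l r : ℝ} (hl : 0 < l) (hr : 0 < r) :
    (typeLaw l r).real {true} = l / (l + r) := by
  rw [measureReal_def, typeLaw]
  simp only [Measure.coe_add, Measure.coe_smul, Pi.add_apply, Pi.smul_apply, smul_eq_mul]
  rw [Measure.dirac_apply_of_mem (by simp), Measure.dirac_apply' _ (measurableSet_singleton _)]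
  simp only [mul_one, Set.mem_singleton_iff, Bool.false_eq_true, not_false_eq_true,
    Set.indicator_of_notMem, mul_zero, add_zero]
  exact ENNReal.toReal_ofReal (by positivity)

lemma ae_typicalTypes {l r : ℝ} (hl : 0 < l) (hr : 0 < r) (K B : ℕ) (S₀ : ℤ) :
    ∀ᵐ z ∂(gapsLaw l r), TypicalTypes K B S₀ (l / (l + r)) fun k => firstType (residual^[k] z) := by
  have := isProbabilityMeasure_typeLaw hl hr
  have := isProbabilityMeasure_gapsLaw hl hr
  -- All the averages concern automata on countable discrete spaces, where measurability is
  -- automatic, with weights bounded by one.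
  have key : ∀ {α : Type} [MeasurableSpace α] [DiscreteMeasurableSpace α] [Countable α]
      (f : α → Bool → α) (s : α) (v : α → ℝ), (∀ x, |v x| ≤ 1) → ∀ᵐ z ∂(gapsLaw l r),
      Tendsto (avg fun j => v (drive f s (fun k => firstType (residual^[k] z)) j) *
        centred (l / (l + r)) (firstType (residual^[j] z))) atTop (𝓝 0) := by
    intro α _ _ _ f s v hv
    exact ae_tendsto_weightedSum_div measurable_firstType measurable_residual
      (map_firstType_residual hl hr) (typeLaw_real_true hl hr) (Measurable.of_discrete) s
      Measurable.of_discrete hv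
  have hlev : ∀ᵐ z ∂(gapsLaw l r), ∀ x : ℤ, _ := ae_all_iff.2 fun x : ℤ =>
    key (levelStep K B) S₀ (atLevel x) fun y => by unfold atLevel; split_ifs <;> simp
  filter_upwards [hlev, key (levelStep K B) S₀ (fun _ => 1) (by simp),
    key (levelStep K B) S₀ negLevel fun y => by unfold negLevel; split_ifs <;> simp,
    key (flagStep K B) (S₀, false) (fun q => bit q.2) fun y => by
      simp only [bit]; split_ifs <;> simp] with z h1 h2 h3 h4
  exact ⟨by simpa only [one_mul] using h2, h1, h3, h4⟩

/-! ### From frequencies per event to rates in time -/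

/-- Rate of a counting process that is controlled by the number of arrivals. -/
lemma tendsto_count_div {a : ℕ → ℝ} (ha : StrictMono a) {l c : ℝ} (hl : 0 < l)
    (hal : Tendsto (fun n : ℕ => a n / ((n : ℝ) + 1)) atTop (𝓝 (1 / l))) {V : ℕ → ℕ}
    (hV : Tendsto (fun m : ℕ => (V m : ℝ) / m) atTop (𝓝 c)) {N : ℝ → ℕ} {C : ℕ}
    (hlow : ∀ m T, a m < T → V m ≤ N T) (hup : ∀ m T, T ≤ a m → N T ≤ V m + C) :
    Tendsto (fun T => (N T : ℝ) / T) atTop (𝓝 (l * c)) := by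
  have hatop := tendsto_atTop_of_tendsto_div (by positivity) hal
  -- `M` is the last arrival index strictly before `T`; then `N T / T` lies between `V M / a (M +
  -- 1)` and `(V (M + 1) + C) / a M`, which have the same limit.
  have hex : ∀ T, ∃ M, a 0 < T → a M < T ∧ T ≤ a (M + 1) := by
    intro T
    by_cases hT : a 0 < T
    · have he : ∃ m, T ≤ a m := (hatop.eventually_ge_atTop T).exists
      classical
      obtain ⟨M, hM⟩ := Nat.exists_eq_succ_of_ne_zero (n := Nat.find he) fun h0 => by
        have := Nat.find_spec he
        rw [h0] at this
        exact absurd hT (not_lt.2 this)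
      refine ⟨M, fun _ => ⟨not_le.1 (Nat.find_min he (by omega)), ?_⟩⟩
      have := Nat.find_spec he
      rwa [hM] at this
    · exact ⟨0, fun h => absurd h hT⟩
  choose M hM using hex
  have hMtop : Tendsto M atTop atTop := by
    refine tendsto_atTop.2 fun b => ?_
    filter_upwards [eventually_gt_atTop (a b), eventually_gt_atTop (a 0)] with T hT hT0
    have := ha.lt_iff_lt.1 (hT.trans_le (hM T hT0).2)
    omega
  have hinv : Tendsto (fun n : ℕ => ((n : ℝ) + 1) / a n) atTop (𝓝 l) := by
    have := hal.inv₀ (by positivity)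
    simp only [inv_div, div_one] at this
    exact this
  have hratio : Tendsto (fun n : ℕ => (n : ℝ) / ((n : ℝ) + 1)) atTop (𝓝 1) :=
    tendsto_natCast_div_add_atTop 1
  have hup' : Tendsto (fun n : ℕ => ((V (n + 1) : ℝ) + C) / a n) atTop (𝓝 (l * c)) := by
    have h1 := hV.comp (tendsto_add_atTop_nat 1)
    have h2 := ((tendsto_const_div_atTop_nhds_zero_nat (C : ℝ)).comp (tendsto_add_atTop_nat 1))
    have := hinv.mul (h1.add h2)
    rw [add_zero] at this
    refine this.congr fun n => ?_
    have : (n : ℝ) + 1 ≠ 0 := by positivity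
    simp only [Function.comp]
    push_cast
    field_simp
  have hlow' : Tendsto (fun n : ℕ => (V n : ℝ) / a (n + 1)) atTop (𝓝 (l * c)) := by
    have hr2 : Tendsto (fun n : ℕ => (n : ℝ) / ((n : ℝ) + 2)) atTop (𝓝 1) :=
      tendsto_natCast_div_add_atTop 2
    have := (hinv.comp (tendsto_add_atTop_nat 1)).mul (hV.mul hr2)
    rw [mul_one] at this
    refine this.congr' ?_
    filter_upwards [eventually_ge_atTop 1] with n hn
    have h0 : (n : ℝ) ≠ 0 := by exact_mod_cast (by omega : n ≠ 0)
    have h2 : (n : ℝ) + 2 ≠ 0 := by positivity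
    simp only [Function.comp]
    push_cast
    rw [show (n : ℝ) + 1 + 1 = n + 2 by ring]
    field_simp
  have hpos : ∀ᶠ T in atTop, 0 < a (M T) :=
    hMtop.eventually (hatop.eventually_gt_atTop 0)
  refine tendsto_of_tendsto_of_tendsto_of_le_of_le' (hlow'.comp hMtop) (hup'.comp hMtop) ?_ ?_
  · filter_upwards [hpos, eventually_gt_atTop (a 0)] with T h0 hT
    have h1 := hM T hT
    have hT0 : 0 < T := h0.trans h1.1
    have : (V (M T) : ℝ) ≤ N T := by exact_mod_cast hlow _ _ h1.1
    simp only [Function.comp]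
    exact div_le_div₀ (Nat.cast_nonneg _) this hT0 h1.2
  · filter_upwards [hpos, eventually_gt_atTop (a 0)] with T h0 hT
    have h1 := hM T hT
    have : (N T : ℝ) ≤ V (M T + 1) + C := by exact_mod_cast hup _ _ h1.2
    simp only [Function.comp]
    exact div_le_div₀ (by positivity) this h0 h1.1.le

/-- Limiting fraction of the status packets that get served. -/
lemma RegularPaths.tendsto_servedCount {K B : ℕ} {S₀ : ℤ} {a e : ℕ → ℝ}
    (h : RegularPaths K B S₀ a e) {p π : ℝ} (hp : 0 < p)
    (htyp : TypicalTypes K B S₀ p (eventType K B S₀ a e))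
    (hπ : Tendsto (avg fun j => negLevel (drive (levelStep K B) S₀ (eventType K B S₀ a e) j))
      atTop (𝓝 π)) :
    Tendsto (fun m : ℕ => (servedCount K B S₀ a e m : ℝ) / m) atTop
      (𝓝 (π + (1 - π) * (1 - p))) := by
  choose k hk _ using h.exists_arrival
  have hle : ∀ j, (run K B S₀ a e j).arrivals ≤ j := by
    intro j
    induction j with
    | zero => exact le_rfl
    | succ j ih =>
      rw [arrivals_succ]
      split_ifs <;> omega
  have hktop : Tendsto k atTop atTop :=
    tendsto_atTop_mono (fun m => (hk m).symm.le.trans (hle (k m))) tendsto_id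
  -- Served arrivals per event divided by arrivals per event, sampled at the event `k m` before
  -- which exactly `m` packets have arrived.
  have hdiv := ((htyp.tendsto_served hπ).div htyp.tendsto_bit hp.ne').comp hktop
  rw [mul_div_cancel_left₀ _ hp.ne'] at hdiv
  refine hdiv.congr' ?_
  filter_upwards [eventually_ge_atTop 1] with m hm
  have hkm : (k m : ℝ) ≠ 0 := by
    have h1 := hle (k m)
    rw [hk] at h1
    exact_mod_cast (by omega : k m ≠ 0)
  have h1 := h.servedCount_arrivals (k m)
  have h2 := arrivals_eq_sum (K := K) (B := B) (S₀ := S₀) (a := a) (e := e) (k m)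
  rw [hk] at h1 h2
  simp only [Function.comp, Pi.div_apply, avg]
  rw [div_div_div_cancel_right₀ hkm, h1]
  congr 1
  · push_cast
    simp only [h.netLevel_run]
  · refine Eq.trans ?_ (congrArg (Nat.cast : ℕ → ℝ) h2).symm
    push_cast
    rfl

end EnergyStatus

theorem lemma3 {Ω : Type*} [MeasurableSpace Ω] (μ : Measure Ω) [IsProbabilityMeasure μ]
    (lam r θ : ℝ) (hlam : 0 < lam) (hr : 0 < r) (hne : lam ≠ r) (hθ : θ = lam / r)
    (K B : ℕ) (hK : 1 ≤ K) (hB : 1 ≤ B) (S₀ : ℤ) (hS₀ : -(B : ℤ) ≤ S₀ ∧ S₀ ≤ (K : ℤ))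
    (A E : ℕ → Ω → ℝ)
    (hA : EnergyStatus.IsPoissonArrivals μ lam A) (hE : EnergyStatus.IsPoissonArrivals μ r E)
    (hAE : IndepFun (fun ω n => A n ω) (fun ω n => E n ω) μ) :
    ∀ᵐ ω ∂μ,
      (∀ n : ℕ,
        EnergyStatus.IsValidUpdate K B S₀ (fun i => A i ω) (fun i => E i ω) (n : ℤ) ↔
          EnergyStatus.BatteryNonemptyOnArrival K B S₀ (fun i => A i ω) (fun i => E i ω) n ∨
            ∃ m : ℕ, A n ω < E m ω ∧ E m ω < A (n + 1) ω) ∧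
      Tendsto
        (fun T : ℝ =>
          (EnergyStatus.validUpdateCount K B S₀ (fun i => A i ω) (fun i => E i ω) T : ℝ) / T)
        atTop
        (𝓝 (lam * (((θ ^ (-(B : ℤ)) - 1) * (1 + θ) + (1 - θ ^ (K + 1))) /
          ((θ ^ (-(B : ℤ)) - θ ^ (K + 1)) * (1 + θ))))) := by
  have hz : Measurable fun ω =>
      (EnergyStatus.increments fun n => A n ω, EnergyStatus.increments fun n => E n ω) :=
    (EnergyStatus.measurable_increments.comp (measurable_pi_lambda _ hA.measurable)).prodMk
      (EnergyStatus.measurable_increments.comp (measurable_pi_lambda _ hE.measurable))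
  have hlaw := EnergyStatus.map_increments_prod hA hE hAE
  have htie := EnergyStatus.ae_no_tie hlam hr
  have htyp := EnergyStatus.ae_typicalTypes hlam hr K B S₀
  rw [← hlaw] at htie htyp
  filter_upwards [hA.ae_tendsto_div hlam, hE.ae_tendsto_div hr, hA.ae_gap_pos, hE.ae_gap_pos,
    ae_of_ae_map hz.aemeasurable htie, ae_of_ae_map hz.aemeasurable htyp]
    with ω hAdiv hEdiv hApos hEpos hno hty
  set a : ℕ → ℝ := fun i => A i ω with ha
  set e : ℕ → ℝ := fun i => E i ω with he
  have hreg : EnergyStatus.RegularPaths K B S₀ a e :=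
    { one_le_K := hK
      one_le_B := hB
      start := hS₀
      status_strictMono := EnergyStatus.strictMono_of_gap_pos hApos
      energy_strictMono := EnergyStatus.strictMono_of_gap_pos hEpos
      status_tendsto := EnergyStatus.tendsto_atTop_of_tendsto_div (by positivity) hAdiv
      energy_tendsto := EnergyStatus.tendsto_atTop_of_tendsto_div (by positivity) hEdiv
      no_tie := fun k hk => hno k (by
        have := (EnergyStatus.residual_iterate K B S₀ a e k).1
        rw [hk, sub_self] at this
        exact sub_eq_zero.1 this) }
  refine ⟨hreg.isValidUpdate_iff, ?_⟩
  have hty' : EnergyStatus.TypicalTypes K B S₀ (lam / (lam + r))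
      (EnergyStatus.eventType K B S₀ a e) := by
    simpa only [EnergyStatus.firstType_residual_iterate K B S₀ a e] using hty
  have hθ0 : 0 < θ := hθ ▸ div_pos hlam hr
  have hθ1 : θ ≠ 1 := fun h1 => hne (by rw [h1, eq_comm, div_eq_one_iff_eq hr.ne'] at hθ; exact hθ)
  have hp1 : lam / (lam + r) < 1 := by rw [div_lt_one (by positivity)]; linarith
  have hpθ : θ = lam / (lam + r) / (1 - lam / (lam + r)) := by
    rw [hθ, one_sub_div (by positivity), add_sub_cancel_left]
    field_simp
  have hpθ' : lam / (lam + r) = θ / (1 + θ) := by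
    rw [hθ]
    field_simp
    ring
  have hV := hreg.tendsto_servedCount (by positivity) hty'
    (hty'.tendsto_negLevel hp1 hpθ hθ0 hS₀)
  rw [hpθ', EnergyStatus.served_frequency_eq hθ0 hθ1] at hV
  -- The additive constant is `S₀.toNat`, the number of packets stored at time `0`.
  exact EnergyStatus.tendsto_count_div hreg.status_strictMono hlam hAdiv hV
    (fun m T => hreg.le_validUpdateCount) fun m T => hreg.validUpdateCount_le
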